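/- Let $\mathcal{C}=\{y\in\mathbb{C}^4 : y_1y_4-y_2y_3=0\}$ be the conifold, with symmetry group $$S=\frac{GL(2,\mathbb{C})\times GL(2,\mathbb{C})}{\mathbb{C}^*}\rtimes\mathbb{Z}_2 ,$$ where $\mathbb{C}^*$ is embedded by $\lambda\mapsto(\lambda,\lambda^{-1})$, the class of a pair $(A,B)$ acts on $Y=\begin{pmatrix} y_1&y_2\\ y_3&y_4\end{pmatrix}$ by $Y\mapsto AYB^{T}$, and the generator of $\mathbb{Z}_2$ acts by $Y\mapsto Y^{T}$ (i.e. $y_2\leftrightarrow y_3$) and, by conjugation, exchanges the two $GL(2,\mathbb{C})$ factors. For a finite subgroup $G\subset S$, the quotient $\mathcal{C}/G$ (the affine variety whose coordinate ring is the ring of $G$-invariant regular functions on $\mathcal{C}$) is called a $G$-hyperconifold if no non-trivial element of $G$ fixes a point of $\mathcal{C}$ other than the origin, and $\mathcal{C}/G$ has an isolated Gorenstein singularity: it is singular exactly at the image of the origin, and its canonical sheaf is a line bundle. There is an element $g\in S$, of order four, that acts by $$(y_1,y_2,y_3,y_4)\mapsto(i\,y_1,\;y_3,\;-y_2,\;i\,y_4).$$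 The quotient of $\mathcal{C}$ by $\langle g\rangle\cong\mathbb{Z}_4$ is a hyperconifold, and $\langle g\rangle$ projects non-trivially to the $\mathbb{Z}_2$ factor of $S$. Up to isomorphism it is the only one: if $G\subset S$ is any finite subgroup that projects non-trivially to the $\mathbb{Z}_2$ factor and $\mathcal{C}/G$ is a $G$-hyperconifold, then $G$ is conjugate to $\langle g\rangle$ in $S$, and $\mathcal{C}/G\cong\mathcal{C}/\langle g\rangle$ as varieties. -/

import Mathlib

noncomputable section

namespace Conifold

/-! ## The conifold -/

/-- Affine four-space with its hypersurface coordinates `y 0, y 1, y 2, y 3`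
(usually written `y₁, y₂, y₃, y₄`). -/
abbrev V : Type := Fin 4 → ℂ

/-- The polynomial `y₁ y₄ - y₂ y₃`, as a function. -/
def p (y : V) : ℂ := y 0 * y 3 - y 1 * y 2

/-- The conifold. -/
abbrev Cone : Type := {y : V // p y = 0}

/-- The smooth locus of the conifold, which is the complement of the origin. -/
abbrev SmoothLocus : Type := {x : Cone // x.1 ≠ 0}

/-- The origin, as a point of the conifold. -/
def origin : Cone := ⟨0, by simp [p]⟩

/-- The differential of `y₁ y₄ - y₂ y₃` at `y`. -/
def dp (y : V) : V →ₗ[ℂ] ℂ where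
  toFun v := y 0 * v 3 + y 3 * v 0 - y 1 * v 2 - y 2 * v 1
  map_add' v w := by simp only [Pi.add_apply]; ring
  map_smul' c v := by simp only [Pi.smul_apply, smul_eq_mul, RingHom.id_apply]; ring

/-- The tangent space of the conifold at a smooth point, as a subspace of `ℂ⁴`. -/
abbrev Tangent (x : SmoothLocus) : Submodule ℂ V := LinearMap.ker (dp x.1.1)

/-! ## The symmetry group `((GL₂ × GL₂) / ℂˣ) ⋊ ℤ₂` -/

/-- The homomorphism from the group of order two that sends the generator to an involution `t`. -/
def zTwoHom {H : Type*} [Group H] (t : H) (ht : t * t = 1) : Multiplicative (ZMod 2) →* H where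
  toFun e := if e = 1 then 1 else t
  map_one' := by simp
  map_mul' a b := by
    have h : ∀ c : Multiplicative (ZMod 2), c = 1 ∨ c = Multiplicative.ofAdd 1 := by decide
    have h1 : (Multiplicative.ofAdd (1 : ZMod 2)) ≠ 1 := by decide
    have h2 : (Multiplicative.ofAdd (1 : ZMod 2)) * Multiplicative.ofAdd (1 : ZMod 2) = 1 := by
      decide
    rcases h a with rfl | rfl <;> rcases h b with rfl | rfl <;> simp [h1, h2, ht]

/-- `GL(2,ℂ) × GL(2,ℂ)`; the first factor acts on the homogeneous coordinates `(z₁, z₂)`,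
the second one on `(z₃, z₄)`. -/
abbrev GLPair : Type := GL (Fin 2) ℂ × GL (Fin 2) ℂ

/-- The homomorphism `l ↦ (l, l⁻¹)` onto the anti-diagonal scalars, which act trivially. -/
def antiDiagonalHom : ℂˣ →* GLPair :=
  MonoidHom.prod (Matrix.GeneralLinearGroup.scalar (Fin 2))
    ((Matrix.GeneralLinearGroup.scalar (Fin 2)).comp (invMonoidHom : ℂˣ →* ℂˣ))

/-- The anti-diagonal copy of `ℂˣ` in `GL(2,ℂ) × GL(2,ℂ)`. -/
abbrev antiDiagonal : Subgroup GLPair := antiDiagonalHom.range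

instance antiDiagonal_normal : antiDiagonal.Normal := by
  constructor
  rintro _ ⟨l, rfl⟩ ⟨A, B⟩
  refine ⟨l, ?_⟩
  have hA := Matrix.GeneralLinearGroup.scalar_commute l A
  have hB := Matrix.GeneralLinearGroup.scalar_commute l⁻¹ B
  ext1
  · change Matrix.GeneralLinearGroup.scalar (Fin 2) l
      = A * Matrix.GeneralLinearGroup.scalar (Fin 2) l * A⁻¹
    rw [← hA, mul_inv_cancel_right]
  · change Matrix.GeneralLinearGroup.scalar (Fin 2) l⁻¹
      = B * Matrix.GeneralLinearGroup.scalar (Fin 2) l⁻¹ * B⁻¹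
    rw [← hB, mul_inv_cancel_right]

/-- The quotient `(GL(2,ℂ) × GL(2,ℂ)) / ℂˣ`. -/
abbrev Connected : Type := GLPair ⧸ antiDiagonal

lemma map_swap_antiDiagonal :
    antiDiagonal.map (MulEquiv.prodComm (M := GL (Fin 2) ℂ) (N := GL (Fin 2) ℂ)).toMonoidHom
      = antiDiagonal := by
  ext x
  constructor
  · rintro ⟨_, ⟨l, rfl⟩, rfl⟩
    refine ⟨l⁻¹, ?_⟩
    ext1 <;> simp [antiDiagonalHom]
  · rintro ⟨l, rfl⟩
    refine ⟨_, ⟨l⁻¹, rfl⟩, ?_⟩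
    ext1 <;> simp [antiDiagonalHom]

/-- The exchange of the two `GL(2,ℂ)` factors. -/
def swapAut : MulAut Connected :=
  QuotientGroup.congr antiDiagonal antiDiagonal MulEquiv.prodComm map_swap_antiDiagonal

lemma swapAut_mul_self : swapAut * swapAut = 1 := by
  ext x
  induction x using QuotientGroup.induction_on with
  | H z => rfl

/-- The symmetry group of the conifold; conjugation by the generator of `ℤ₂` exchanges the two
`GL(2,ℂ)` factors. -/
abbrev Sym : Type :=
  Connected ⋊[zTwoHom swapAut swapAut_mul_self] Multiplicative (ZMod 2)

/-- The projection of the symmetry group onto its `ℤ₂` factor. -/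
abbrev toZTwo : Sym →* Multiplicative (ZMod 2) := SemidirectProduct.rightHom

/-! ### The action on the hypersurface coordinates

In the homogeneous coordinates `y₁ = z₁ z₃`, `y₂ = z₁ z₄`, `y₃ = z₂ z₃`, `y₄ = z₂ z₄`, so the matrix
`(y₁ y₂; y₃ y₄)` is the product of the column `(z₁, z₂)` and the row `(z₃, z₄)`. A pair `(A, B)`
sends the matrix `Y` to `A Y Bᵀ`, and the exchange of `(z₁, z₂)` with `(z₃, z₄)` transposes it. -/

/-- The hypersurface coordinates, arranged as a matrix. -/
def toMatrix : V ≃ₗ[ℂ] Matrix (Fin 2) (Fin 2) ℂ where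
  toFun y := !![y 0, y 1; y 2, y 3]
  invFun Y := ![Y 0 0, Y 0 1, Y 1 0, Y 1 1]
  map_add' y z := by ext i j; fin_cases i <;> fin_cases j <;> rfl
  map_smul' c y := by ext i j; fin_cases i <;> fin_cases j <;> rfl
  left_inv y := by ext i; fin_cases i <;> rfl
  right_inv Y := by ext i j; fin_cases i <;> fin_cases j <;> rfl

/-- The map `Y ↦ A Y Bᵀ` on the space of matrices. -/
def sandwich (A B : Matrix (Fin 2) (Fin 2) ℂ) :
    Matrix (Fin 2) (Fin 2) ℂ →ₗ[ℂ] Matrix (Fin 2) (Fin 2) ℂ where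
  toFun Y := A * Y * B.transpose
  map_add' Y Z := by rw [Matrix.mul_add, Matrix.add_mul]
  map_smul' c Y := by simp

/-- The action of `GL(2,ℂ) × GL(2,ℂ)` on the hypersurface coordinates. -/
def glHom : GLPair →* (V ≃ₗ[ℂ] V) :=
  (LinearMap.GeneralLinearGroup.generalLinearEquiv ℂ V).toMonoidHom.comp <|
    MonoidHom.toHomUnits
      { toFun := fun a => toMatrix.symm.toLinearMap ∘ₗ sandwich a.1.1 a.2.1 ∘ₗ toMatrix.toLinearMap
        map_one' := by
          refine LinearMap.ext fun y => ?_
          simp [sandwich]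
        map_mul' := fun a b => by
          refine LinearMap.ext fun y => ?_
          simp [sandwich, Matrix.mul_assoc] }

lemma glHom_apply (a : GLPair) (y : V) :
    glHom a y = toMatrix.symm (a.1.1 * toMatrix y * a.2.1.transpose) := rfl

/-- The action of `(GL(2,ℂ) × GL(2,ℂ)) / ℂˣ` on the hypersurface coordinates. -/
def connectedHom : Connected →* (V ≃ₗ[ℂ] V) :=
  QuotientGroup.lift antiDiagonal glHom <| by
    rintro _ ⟨l, rfl⟩
    ext1 y
    have h : (Matrix.scalar (Fin 2) (l : ℂ)) * toMatrix y
        * (Matrix.scalar (Fin 2) ((l⁻¹ : ℂˣ) : ℂ)).transpose = toMatrix y := by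
      ext i j
      simp [mul_right_comm]
    change toMatrix.symm ((Matrix.scalar (Fin 2) (l : ℂ)) * toMatrix y
        * (Matrix.scalar (Fin 2) ((l⁻¹ : ℂˣ) : ℂ)).transpose) = y
    rw [h, LinearEquiv.symm_apply_apply]

/-- The exchange of `y₂` and `y₃`. -/
def transposeEquiv : V ≃ₗ[ℂ] V :=
  toMatrix.trans ((Matrix.transposeLinearEquiv (Fin 2) (Fin 2) ℂ ℂ).trans toMatrix.symm)

lemma transposeEquiv_apply (y : V) :
    transposeEquiv y = toMatrix.symm (toMatrix y).transpose := rfl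

lemma transposeEquiv_mul_self : transposeEquiv * transposeEquiv = 1 := by
  ext1 y
  simp [transposeEquiv_apply]

/-- The action of the symmetry group on the hypersurface coordinates. -/
def rep : Sym →* (V ≃ₗ[ℂ] V) :=
  SemidirectProduct.lift connectedHom (zTwoHom transposeEquiv transposeEquiv_mul_self) <| by
    intro e
    have h : ∀ c : Multiplicative (ZMod 2), c = 1 ∨ c = Multiplicative.ofAdd 1 := by decide
    have h1 : (Multiplicative.ofAdd (1 : ZMod 2)) ≠ 1 := by decide
    rcases h e with rfl | rfl
    · ext x y
      simp
    · have ht : transposeEquiv⁻¹ = transposeEquiv :=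
        inv_eq_of_mul_eq_one_left transposeEquiv_mul_self
      refine MonoidHom.ext fun x => ?_
      induction x using QuotientGroup.induction_on with
      | H a =>
        ext1 y
        simp only [zTwoHom, MonoidHom.coe_mk, OneHom.coe_mk, h1, if_false, MonoidHom.comp_apply,
          MulEquiv.coe_toMonoidHom, MulAut.conj_apply, ht, LinearEquiv.mul_apply]
        change glHom (a.2, a.1) y = transposeEquiv (glHom a (transposeEquiv y))
        simp [glHom_apply, transposeEquiv_apply, Matrix.mul_assoc]

lemma exists_multiplier (s : Sym) : ∃ c : ℂ, ∀ y, p (rep s y) = c * p y := by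
  have hp : ∀ y : V, p y = (toMatrix y).det := fun y => by
    simp [toMatrix, p, Matrix.det_fin_two]
  have hconn : ∀ x : Connected, ∃ c : ℂ, ∀ y, p (connectedHom x y) = c * p y := by
    intro x
    induction x using QuotientGroup.induction_on with
    | H a =>
      refine ⟨a.1.1.det * a.2.1.det, fun y => ?_⟩
      change p (glHom a y) = _
      rw [glHom_apply, hp, hp, LinearEquiv.apply_symm_apply, Matrix.det_mul, Matrix.det_mul,
        Matrix.det_transpose]
      ring
  have htr : ∀ e y, p (zTwoHom transposeEquiv transposeEquiv_mul_self e y) = p y := by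
    intro e y
    by_cases he : e = 1
    · simp [he]
    · simp only [zTwoHom, MonoidHom.coe_mk, OneHom.coe_mk, he, if_false]
      rw [hp, hp, transposeEquiv_apply, LinearEquiv.apply_symm_apply, Matrix.det_transpose]
  obtain ⟨c, hc⟩ := hconn s.left
  refine ⟨c, fun y => ?_⟩
  change p (connectedHom s.left (zTwoHom transposeEquiv transposeEquiv_mul_self s.right y)) = _
  rw [hc, htr]

/-- The action of a symmetry on the conifold. -/
def act (s : Sym) (x : Cone) : Cone :=
  ⟨rep s x.1, by
    obtain ⟨c, hc⟩ := exists_multiplier s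
    rw [hc, x.2, mul_zero]⟩

/-- The action of a symmetry on the smooth locus. -/
def actSmooth (s : Sym) (x : SmoothLocus) : SmoothLocus :=
  ⟨act s x.1, fun h => x.2 ((rep s).map_eq_zero_iff.mp h)⟩

/-- The differential of a symmetry, between the tangent spaces at a smooth point and its image. -/
def tangentMap (s : Sym) (x : SmoothLocus) : Tangent x →ₗ[ℂ] Tangent (actSmooth s x) :=
  (rep s).toLinearMap.restrict fun v hv => by
    obtain ⟨c, hc⟩ := exists_multiplier s
    have polar : ∀ y w : V, dp y w = p (y + w) - p y - p w := fun y w => by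
      simp only [dp, p, LinearMap.coe_mk, AddHom.coe_mk, Pi.add_apply]; ring
    have hv' : dp x.1.1 v = 0 := hv
    change dp (rep s x.1.1) (rep s v) = 0
    rw [polar, ← map_add, hc, hc, hc, ← mul_sub, ← mul_sub, ← polar, hv', mul_zero]

/-! ## The quotient by a group of symmetries -/

/-- The coordinate ring of the conifold: the functions on it that are given by polynomials. -/
def coordinateRing : Subalgebra ℂ (Cone → ℂ) :=
  (MvPolynomial.aeval (fun (i : Fin 4) (x : Cone) => x.1 i) :
    MvPolynomial (Fin 4) ℂ →ₐ[ℂ] (Cone → ℂ)).range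

/-- The coordinate ring of the quotient of the conifold by `G`: the `G`-invariant regular
functions. The quotient is the affine variety with this coordinate ring. -/
def quotientRing (G : Subgroup Sym) : Subalgebra ℂ (Cone → ℂ) where
  carrier := {f | f ∈ coordinateRing ∧ ∀ s ∈ G, ∀ x, f (act s x) = f x}
  mul_mem' := fun {f g} hf hg => ⟨mul_mem hf.1 hg.1, fun s hs x => by
    rw [Pi.mul_apply, Pi.mul_apply, hf.2 s hs, hg.2 s hs]⟩
  add_mem' := fun {f g} hf hg => ⟨add_mem hf.1 hg.1, fun s hs x => by
    rw [Pi.add_apply, Pi.add_apply, hf.2 s hs, hg.2 s hs]⟩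
  algebraMap_mem' c := ⟨algebraMap_mem _ c, fun _ _ _ => rfl⟩

/-- Evaluation of functions on the quotient at the image of the point `x` of the conifold. -/
def evalAt (G : Subgroup Sym) (x : Cone) : quotientRing G →ₐ[ℂ] ℂ :=
  (Pi.evalAlgHom ℂ (fun _ : Cone => ℂ) x).comp (quotientRing G).val

/-- The maximal ideal of the image of `x` in the quotient. -/
def maximalIdealAt (G : Subgroup Sym) (x : Cone) : Ideal (quotientRing G) :=
  RingHom.ker (evalAt G x)

instance (G : Subgroup Sym) (x : Cone) : (maximalIdealAt G x).IsPrime :=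
  RingHom.ker_isPrime (evalAt G x)

/-- The quotient is smooth at the image of `x`: its local ring there is regular. -/
def IsSmoothAt (G : Subgroup Sym) (x : Cone) : Prop :=
  IsRegularLocalRing (Localization.AtPrime (maximalIdealAt G x))

/-! ### The canonical module of the quotient -/

/-- Families of alternating 3-forms on the tangent spaces at the smooth points of the conifold. -/
def ThreeForm : Type := ∀ x : SmoothLocus, Tangent x [⋀^Fin 3]→ₗ[ℂ] ℂ

instance : AddCommGroup ThreeForm :=
  inferInstanceAs (AddCommGroup (∀ x : SmoothLocus, Tangent x [⋀^Fin 3]→ₗ[ℂ] ℂ))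

/-- Functions on the conifold act pointwise on 3-forms. -/
instance : Module (Cone → ℂ) ThreeForm where
  smul f w := fun x => f x.1 • w x
  one_smul w := funext fun x => one_smul ℂ (w x)
  mul_smul f g w := funext fun x => mul_smul (f x.1) (g x.1) (w x)
  smul_zero f := funext fun x => smul_zero (f x.1)
  smul_add f w z := funext fun x => smul_add (f x.1) (w x) (z x)
  add_smul f g w := funext fun x => add_smul (f x.1) (g x.1) (w x)
  zero_smul w := funext fun x => zero_smul ℂ (w x)

/-- A 3-form is regular on the smooth locus if on each of the affine open sets `y i ≠ 0`, which
cover it, some `(y i) ^ N` times the form is the restriction of a tensor with polynomial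
coefficients on `ℂ⁴`. -/
def IsRegularForm (w : ThreeForm) : Prop :=
  ∀ i : Fin 4, ∃ (N : ℕ) (P : (Fin 3 → Fin 4) → MvPolynomial (Fin 4) ℂ),
    ∀ x : SmoothLocus, x.1.1 i ≠ 0 → ∀ v : Fin 3 → Tangent x,
      x.1.1 i ^ N * w x v
        = ∑ J : Fin 3 → Fin 4, MvPolynomial.eval x.1.1 (P J) * ∏ k, (v k : V) (J k)

/-- A 3-form is invariant if it equals its pullback under every element of `G`. -/
def IsInvariantForm (G : Subgroup Sym) (w : ThreeForm) : Prop :=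
  ∀ s ∈ G, ∀ x : SmoothLocus, (w (actSmooth s x)).compLinearMap (tangentMap s x) = w x

/-- The canonical module of the quotient by a group `G` that acts freely outside of the origin.
The canonical sheaf of a normal threefold is the sheaf of regular 3-forms on the smooth locus, or
outside of a finite set of points that contains the singular ones. Outside of the origin the
conifold is an étale cover of the quotient, so these forms on the quotient are the invariant
regular 3-forms on the smooth locus of the conifold. -/
def canonicalModule (G : Subgroup Sym) : Submodule (quotientRing G) ThreeForm where
  carrier := {w | IsRegularForm w ∧ IsInvariantForm G w}
  zero_mem' := ⟨fun i => ⟨0, 0, fun x _ v => by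
      change _ * (0 : Tangent x [⋀^Fin 3]→ₗ[ℂ] ℂ) v = _
      simp⟩, fun s _ x => rfl⟩
  add_mem' := by
    rintro w z ⟨hw, hw'⟩ ⟨hz, hz'⟩
    refine ⟨fun i => ?_, fun s hs x => ?_⟩
    · obtain ⟨N, P, hP⟩ := hw i
      obtain ⟨M, Q, hQ⟩ := hz i
      refine ⟨N + M, fun J => MvPolynomial.X i ^ M * P J + MvPolynomial.X i ^ N * Q J,
        fun x hx v => ?_⟩
      change _ * (w x v + z x v) = _
      calc x.1.1 i ^ (N + M) * (w x v + z x v)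
          = x.1.1 i ^ M * (x.1.1 i ^ N * w x v) + x.1.1 i ^ N * (x.1.1 i ^ M * z x v) := by ring
        _ = _ := by
          rw [hP x hx v, hQ x hx v, Finset.mul_sum, Finset.mul_sum, ← Finset.sum_add_distrib]
          refine Finset.sum_congr rfl fun J _ => ?_
          simp only [map_add, map_mul, map_pow, MvPolynomial.eval_X]
          ring
    · change (w _ + z _).compLinearMap _ = w x + z x
      rw [AlternatingMap.add_compLinearMap, hw' s hs x, hz' s hs x]
  smul_mem' := by
    rintro ⟨f, ⟨F, hF⟩, hf⟩ w ⟨hw, hw'⟩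
    have hfF : ∀ x : Cone, f x = MvPolynomial.eval x.1 F := fun x => by
      rw [← hF]
      change Pi.evalAlgHom ℂ (fun _ : Cone => ℂ) x (MvPolynomial.aeval _ F) = _
      rw [← AlgHom.comp_apply, MvPolynomial.comp_aeval, MvPolynomial.aeval_eq_eval]
      rfl
    refine ⟨fun i => ?_, fun s hs x => ?_⟩
    · obtain ⟨N, P, hP⟩ := hw i
      refine ⟨N, fun J => F * P J, fun x hx v => ?_⟩
      change _ * (f x.1 * w x v) = _
      rw [mul_left_comm, hP x hx v, hfF, Finset.mul_sum]
      refine Finset.sum_congr rfl fun J _ => ?_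
      rw [map_mul, mul_assoc]
    · change (f (act s x.1) • w _).compLinearMap _ = f x.1 • w x
      rw [hf s hs, ← hw' s hs x]
      rfl

instance (G : Subgroup Sym) : AddCommGroup (canonicalModule G) :=
  Submodule.addCommGroup (canonicalModule G)

instance (G : Subgroup Sym) : Module (quotientRing G) (canonicalModule G) :=
  Submodule.module (canonicalModule G)

instance (G : Subgroup Sym) : SMul (quotientRing G) (canonicalModule G) :=
  (inferInstance : Module (quotientRing G) (canonicalModule G)).toSMul

/-! ## Hyperconifolds -/

/-- `G` is a finite group of symmetries of the conifold that acts freely outside of the origin, and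
the quotient of the conifold by `G` has an isolated Gorenstein singularity: it is singular exactly
at the image of the origin, and its canonical sheaf is a line bundle. -/
structure IsHyperconifold (G : Subgroup Sym) : Prop where
  finite : Finite G
  free : ∀ s ∈ G, s ≠ 1 → ∀ x : Cone, act s x = x → x = origin
  isolated : ∀ x : Cone, ¬ IsSmoothAt G x ↔ x = origin
  gorenstein : Module.Invertible (quotientRing G) (canonicalModule G)

/-- The group `G` projects non-trivially to the `ℤ₂` factor of the symmetry group. -/
def ProjectsNontrivially (G : Subgroup Sym) : Prop := ∃ s ∈ G, toZTwo s ≠ 1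

end Conifold

end

noncomputable section

namespace Conifold

open MvPolynomial

/-! ## Regular functions on the conifold -/

/-! The Gorenstein condition becomes a condition on a character. The residue ω of the standard
4-form divided by `p` vanishes nowhere on the smooth locus, and functions regular there extend over
the origin, so the regular 3-forms are exactly the f ω with f regular. A symmetry s multiplies ω by
`residueFactor s`, so the canonical module of the quotient consists of the semi-invariants of this
character. If the character is trivial on G, the module is free on ω. If not, every semi-invariant
vanishes at the origin; a local generator there would also vanish along a curve through the origin,
although the free action provides, at any other point, a semi-invariant that does not vanish. Hence
the character is trivial (`residueFactor_eq_one`).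

An exchanging element s is Y ↦ A Yᵀ Bᵀ, with factor -det A det B, so det(AB) = -1. A non-exchanging
(P, Q) fixes a nonzero rank one matrix as soon as an eigenvalue of P times one of Q is 1. Applied to
s⁴ and to s² = (AB, BA), this forces AB to be a scalar c with c² = -1, so s² is Y ↦ -Y
(`ActsFreely.exists_mul_eq_sc`). If h in G does not exchange the factors, hs has the same property,
whence h s h = s, and eigenvalues again leave only h = ±1 (`ActsFreely.inner_eq`). So G is generated
by s. Conjugation brings A to diag(1, i), and passing to the inverse of s exchanges c = i and c = -i
(`exists_conj_zpowers`).

For the generator itself, freeness and triviality of the character are direct. Away from the origin,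
invariants built from functions that separate an orbit generate the maximal ideal locally, by
Nakayama, and there are as many of them as a chain of primes allows for (`isSmoothAt_of_ne_origin`).
At the origin, four independent point derivations exceed the height, which is at most 3
(`ActsAsGenerator.not_isSmoothAt_origin`). -/

lemma mem_coordinateRing_iff {f : Cone → ℂ} :
    f ∈ coordinateRing ↔ ∃ F : MvPolynomial (Fin 4) ℂ, ∀ x : Cone, f x = eval x.1 F := by
  have key : ∀ (F : MvPolynomial (Fin 4) ℂ) (x : Cone),
      (MvPolynomial.aeval (fun (i : Fin 4) (x : Cone) => x.1 i) :
        MvPolynomial (Fin 4) ℂ →ₐ[ℂ] (Cone → ℂ)) F x = eval x.1 F := fun F x => by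
    change Pi.evalAlgHom ℂ (fun _ : Cone => ℂ) x (MvPolynomial.aeval _ F) = _
    rw [← AlgHom.comp_apply, MvPolynomial.comp_aeval, MvPolynomial.aeval_eq_eval]
    rfl
  rw [coordinateRing, AlgHom.mem_range]
  refine exists_congr fun F => ?_
  rw [funext_iff]
  exact forall_congr' fun x => by rw [key, eq_comm]

lemma coord_mem (i : Fin 4) : (fun x : Cone => x.1 i) ∈ coordinateRing :=
  mem_coordinateRing_iff.2 ⟨X i, fun x => by simp⟩

lemma const_mem (c : ℂ) : (fun _ : Cone => c) ∈ coordinateRing :=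
  mem_coordinateRing_iff.2 ⟨C c, fun x => by simp⟩

lemma rep_apply_eq_sum (s : Sym) (y : V) (i : Fin 4) :
    rep s y i = ∑ j, rep s (Pi.single j 1) i * y j := by
  have h := congrFun (LinearMap.pi_apply_eq_sum_univ (rep s).toLinearMap y) i
  simp only [Finset.sum_apply, Pi.smul_apply, smul_eq_mul, LinearEquiv.coe_coe] at h
  rw [h]
  refine Finset.sum_congr rfl fun j _ => ?_
  have hj : (fun k => if j = k then (1 : ℂ) else 0) = Pi.single j 1 := by
    ext k
    simp [Pi.single_apply, eq_comm]
  rw [mul_comm, hj]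

lemma comp_act_mem {f : Cone → ℂ} (hf : f ∈ coordinateRing) (s : Sym) :
    (fun x => f (act s x)) ∈ coordinateRing := by
  obtain ⟨F, hF⟩ := mem_coordinateRing_iff.1 hf
  refine mem_coordinateRing_iff.2
    ⟨bind₁ (fun i => ∑ j, C (rep s (Pi.single j 1) i) * X j) F, fun x => ?_⟩
  rw [hF, ← MvPolynomial.coe_aeval_eq_eval, ← MvPolynomial.coe_aeval_eq_eval]
  simp only [RingHom.coe_coe, aeval_bind₁]
  congr 2
  ext i
  simp [act, rep_apply_eq_sum s x.1 i]

@[simp] lemma act_one (x : Cone) : act 1 x = x := by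
  apply Subtype.ext; simp [act]

lemma act_mul (s t : Sym) (x : Cone) : act (s * t) x = act s (act t x) := by
  apply Subtype.ext; simp [act]

@[simp] lemma act_origin (s : Sym) : act s origin = origin := by
  apply Subtype.ext; simp [act, origin]

lemma act_inv_act (s : Sym) (x : Cone) : act s⁻¹ (act s x) = x := by
  rw [← act_mul, inv_mul_cancel, act_one]

lemma act_act_inv (s : Sym) (x : Cone) : act s (act s⁻¹ x) = x := by
  rw [← act_mul, mul_inv_cancel, act_one]

/-- A regular function takes the value one at a given point and zero at finitely many others. -/
lemma exists_separating {ι : Type*} [Finite ι] (x : Cone) (y : ι → Cone) (h : ∀ i, y i ≠ x) :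
    ∃ f ∈ coordinateRing, f x = 1 ∧ ∀ i, f (y i) = 0 := by
  have := Fintype.ofFinite ι
  have h1 : ∀ i, ∃ j, (y i).1 j ≠ x.1 j := fun i => by
    by_contra! hc
    exact h i (Subtype.ext (funext hc))
  choose j hj using h1
  refine ⟨∏ i, ((fun z : Cone => z.1 (j i)) - fun _ => (y i).1 (j i)) *
    (fun _ : Cone => (x.1 (j i) - (y i).1 (j i))⁻¹),
    prod_mem fun i _ => mul_mem (sub_mem (coord_mem _) (const_mem _)) (const_mem _), ?_, ?_⟩
  · rw [Finset.prod_apply]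
    refine Finset.prod_eq_one fun i _ => ?_
    exact mul_inv_cancel₀ (sub_ne_zero.2 (hj i).symm)
  · intro i
    rw [Finset.prod_apply]
    refine Finset.prod_eq_zero (Finset.mem_univ i) ?_
    simp

/-- A family of points of the conifold that is parametrized by polynomials. -/
def IsPolynomialMap {σ : Type*} (φ : (σ → ℂ) → Cone) : Prop :=
  ∀ i, ∃ P : MvPolynomial σ ℂ, ∀ t, (φ t).1 i = eval t P

lemma IsPolynomialMap.exists_eval {σ : Type*} {φ : (σ → ℂ) → Cone} (hφ : IsPolynomialMap φ)
    {f : Cone → ℂ} (hf : f ∈ coordinateRing) :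
    ∃ P : MvPolynomial σ ℂ, ∀ t, f (φ t) = eval t P := by
  obtain ⟨F, hF⟩ := mem_coordinateRing_iff.1 hf
  choose P hP using hφ
  refine ⟨bind₁ P F, fun t => ?_⟩
  rw [hF, ← MvPolynomial.coe_aeval_eq_eval, ← MvPolynomial.coe_aeval_eq_eval]
  simp only [RingHom.coe_coe, aeval_bind₁]
  congr 2
  ext i
  simp [hP]

/-- Pulling back along φ lands in a polynomial ring, which is a domain, and over the infinite field
ℂ a polynomial is determined by its values. Irreducibility of the conifold and primality of the
ideals of lines and planes all come from this. -/
lemma IsPolynomialMap.eq_zero_or {σ : Type*} {φ : (σ → ℂ) → Cone} (hφ : IsPolynomialMap φ)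
    {f g : Cone → ℂ} (hf : f ∈ coordinateRing) (hg : g ∈ coordinateRing)
    (h : ∀ t, f (φ t) * g (φ t) = 0) : (∀ t, f (φ t) = 0) ∨ ∀ t, g (φ t) = 0 := by
  obtain ⟨P, hP⟩ := hφ.exists_eval hf
  obtain ⟨Q, hQ⟩ := hφ.exists_eval hg
  have h0 : P * Q = 0 := MvPolynomial.funext fun t => by
    rw [map_mul, ← hP, ← hQ, h, map_zero]
  rcases mul_eq_zero.1 h0 with rfl | rfl
  · exact Or.inl fun t => by simp [hP]
  · exact Or.inr fun t => by simp [hQ]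

/-- The rank one matrix with the given column and row. -/
def segre (z : Fin 4 → ℂ) : Cone :=
  ⟨![z 0 * z 2, z 0 * z 3, z 1 * z 2, z 1 * z 3], by simp [p]; ring⟩

lemma isPolynomialMap_segre : IsPolynomialMap segre := by
  intro i
  fin_cases i
  · exact ⟨X 0 * X 2, fun t => by simp [segre]⟩
  · exact ⟨X 0 * X 3, fun t => by simp [segre]⟩
  · exact ⟨X 1 * X 2, fun t => by simp [segre]⟩
  · exact ⟨X 1 * X 3, fun t => by simp [segre]⟩

lemma segre_surjective : Function.Surjective segre := by
  rintro ⟨y, hy⟩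
  have hy' : y 0 * y 3 = y 1 * y 2 := sub_eq_zero.1 hy
  by_cases h0 : y 0 = 0
  · by_cases h1 : y 1 = 0
    · refine ⟨![0, 1, y 2, y 3], Subtype.ext (funext fun i => ?_)⟩
      fin_cases i <;> simp [segre, h0, h1]
    · have h2 : y 2 = 0 := by
        rw [h0, zero_mul] at hy'
        exact (mul_eq_zero.1 hy'.symm).resolve_left h1
      refine ⟨![y 1, y 3, 0, 1], Subtype.ext (funext fun i => ?_)⟩
      fin_cases i <;> simp [segre, h0, h2]
  · refine ⟨![1, y 2 / y 0, y 0, y 1], Subtype.ext (funext fun i => ?_)⟩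
    fin_cases i <;> simp [segre]
    · field_simp
    · field_simp; rw [mul_comm, ← hy', mul_comm]

/-- The conifold is irreducible. -/
lemma eq_zero_or_eq_zero_of_mul {f g : Cone → ℂ} (hf : f ∈ coordinateRing)
    (hg : g ∈ coordinateRing) (h : ∀ x, f x * g x = 0) : (∀ x, f x = 0) ∨ ∀ x, g x = 0 := by
  rcases isPolynomialMap_segre.eq_zero_or hf hg (fun t => h _) with h | h
  · exact Or.inl (segre_surjective.forall.2 h)
  · exact Or.inr (segre_surjective.forall.2 h)

instance : IsDomain coordinateRing :=
  have : NoZeroDivisors coordinateRing := ⟨fun {f g} h => by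
    rcases eq_zero_or_eq_zero_of_mul f.2 g.2 (fun x => congrFun (congrArg Subtype.val h) x)
      with h | h
    · exact Or.inl (Subtype.ext (funext h))
    · exact Or.inr (Subtype.ext (funext h))⟩
  have : Nontrivial coordinateRing := ⟨0, 1, fun h => by
    simpa using congrFun (congrArg Subtype.val h) origin⟩
  NoZeroDivisors.to_isDomain _

/-! ## Extension of regular functions over the origin -/

/-- Modulo `X i`, a polynomial agrees with the result of substituting zero for `X i`, and that
substitution vanishes identically here. -/
lemma X_dvd_of_eval_update {F : MvPolynomial (Fin 4) ℂ} (i : Fin 4)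
    (h : ∀ y : V, y i = 0 → eval y F = 0) : X i ∣ F := by
  have h0 : bind₁ (fun j => if j = i then (0 : MvPolynomial (Fin 4) ℂ) else X j) F = 0 := by
    refine MvPolynomial.funext fun y => ?_
    rw [map_zero, ← h (fun j => if j = i then 0 else y j) (by simp),
      ← MvPolynomial.coe_aeval_eq_eval, ← MvPolynomial.coe_aeval_eq_eval]
    simp only [RingHom.coe_coe, aeval_bind₁]
    congr 2
    ext j
    split_ifs <;> simp
  rw [← Ideal.mem_span_singleton, ← Ideal.Quotient.eq_zero_iff_mem]
  set q := Ideal.Quotient.mkₐ ℂ (Ideal.span {(X i : MvPolynomial (Fin 4) ℂ)})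
  have h1 : q.comp (bind₁ (fun j => if j = i then (0 : MvPolynomial (Fin 4) ℂ) else X j)) = q := by
    refine MvPolynomial.algHom_ext fun j => ?_
    simp only [AlgHom.comp_apply, bind₁_X_right]
    split_ifs with hj
    · rw [map_zero, hj]
      exact (Ideal.Quotient.eq_zero_iff_mem.2 (Ideal.mem_span_singleton_self _)).symm
    · rfl
  change q F = 0
  rw [← h1, AlgHom.comp_apply, h0, map_zero]

/-- On the conifold, y₁ = 0 cuts out the two planes y₁ = y₂ = 0 and y₁ = y₃ = 0. No power of y₄
vanishes identically on either, so `a` vanishes on both. Thus the part of a representing polynomial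
without y₁ is divisible by y₂ y₃, which equals y₁ y₄ on the conifold. -/
lemma exists_eq_coord_mul {a b : Cone → ℂ} (ha : a ∈ coordinateRing)
    (M : ℕ) (h : ∀ x : Cone, a x * x.1 3 ^ M = x.1 0 * b x) :
    ∃ c ∈ coordinateRing, ∀ x : Cone, a x = x.1 0 * c x := by
  obtain ⟨F, hF⟩ := mem_coordinateRing_iff.1 ha
  -- polynomials that vanish where the zeroth coordinate and one of the middle ones are zero
  have hvan : ∀ y : V, p y = 0 → y 0 = 0 → eval y F * y 3 ^ M = 0 := fun y hy h0 => by
    have := h ⟨y, hy⟩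
    rw [hF] at this
    simpa [h0] using this
  have hplane : ∀ i : Fin 4, i = 1 ∨ i = 2 → ∀ y : V, y 0 = 0 → y i = 0 → eval y F = 0 := by
    intro i hi y h0 hyi
    have hP : bind₁ (fun j => if j = i ∨ j = 0 then (0 : MvPolynomial (Fin 4) ℂ) else X j) F = 0
        := by
      have hmul : bind₁ (fun j => if j = i ∨ j = 0 then
          (0 : MvPolynomial (Fin 4) ℂ) else X j) F * X 3 ^ M = 0 := by
        refine MvPolynomial.funext fun y => ?_
        have := hvan (fun j => if j = i ∨ j = 0 then 0 else y j)
          (by rcases hi with rfl | rfl <;> simp [p]) (by simp)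
        rw [map_zero, map_mul, ← this]
        congr 1
        · rw [← MvPolynomial.coe_aeval_eq_eval, ← MvPolynomial.coe_aeval_eq_eval]
          simp only [RingHom.coe_coe, aeval_bind₁]
          congr 2
          ext j
          split_ifs <;> simp
        · rcases hi with rfl | rfl <;> simp
      exact (mul_eq_zero.1 hmul).resolve_right (pow_ne_zero _ (X_ne_zero _))
    have h2 := congrArg (eval y) hP
    rw [map_zero, ← MvPolynomial.coe_aeval_eq_eval] at h2
    rw [← h2, ← MvPolynomial.coe_aeval_eq_eval]
    simp only [RingHom.coe_coe, aeval_bind₁]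
    congr 2
    ext j
    split_ifs with hj
    · rcases hj with rfl | rfl <;> simp [*]
    · simp
  set H := bind₁ (fun j => if j = 0 then (0 : MvPolynomial (Fin 4) ℂ) else X j) F with hH
  have hHe : ∀ y : V, eval y H = eval (fun j => if j = 0 then 0 else y j) F := fun y => by
    rw [hH, ← MvPolynomial.coe_aeval_eq_eval, ← MvPolynomial.coe_aeval_eq_eval]
    simp only [RingHom.coe_coe, aeval_bind₁]
    congr 2
    ext j
    split_ifs <;> simp
  obtain ⟨F₁, hF₁⟩ : X 0 ∣ F - H := X_dvd_of_eval_update 0 fun y hy => by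
    rw [map_sub, hHe]
    have : (fun j => if j = 0 then 0 else y j) = y := by
      ext j
      split_ifs with hj
      · rw [hj, hy]
      · rfl
    rw [this, sub_self]
  obtain ⟨H₁, hH₁⟩ : X 1 ∣ H := X_dvd_of_eval_update 1 fun y hy => by
    rw [hHe]
    exact hplane 1 (Or.inl rfl) _ (by simp) (by simp [hy])
  obtain ⟨H₂, hH₂⟩ : X 2 ∣ H₁ := by
    refine ((X_prime (R := ℂ) (i := (2 : Fin 4))).dvd_or_dvd (a := X 1) ?_).resolve_left ?_
    · rw [← hH₁]
      refine X_dvd_of_eval_update 2 fun y hy => ?_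
      rw [hHe]
      exact hplane 2 (Or.inr rfl) _ (by simp) (by simp [hy])
    · intro hd
      rw [X_dvd_X] at hd
      simp at hd
  refine ⟨fun x => eval x.1 (F₁ + X 3 * H₂), mem_coordinateRing_iff.2 ⟨_, fun _ => rfl⟩,
    fun x => ?_⟩
  have hx : x.1 0 * x.1 3 = x.1 1 * x.1 2 := sub_eq_zero.1 x.2
  have hFe : F = X 0 * F₁ + X 1 * (X 2 * H₂) := by
    rw [← hF₁, ← hH₂, ← hH₁]; ring
  rw [hF, hFe]
  simp only [map_add, map_mul, eval_X]
  linear_combination (-eval x.1 H₂) * hx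

lemma exists_eq_coord_pow_mul {a b : Cone → ℂ} (ha : a ∈ coordinateRing)
    (hb : b ∈ coordinateRing) (M N : ℕ) (h : ∀ x : Cone, a x * x.1 3 ^ M = x.1 0 ^ N * b x) :
    ∃ c ∈ coordinateRing, ∀ x : Cone, a x = x.1 0 ^ N * c x := by
  induction N generalizing a with
  | zero => exact ⟨a, ha, fun x => by simp⟩
  | succ N ih =>
    obtain ⟨c, hc, hac⟩ := exists_eq_coord_mul (b := fun x => x.1 0 ^ N * b x) ha M (fun x => by
        rw [h x]; ring)
    have hc' : ∀ x : Cone, c x * x.1 3 ^ M = x.1 0 ^ N * b x := by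
      have := eq_zero_or_eq_zero_of_mul (coord_mem 0) (sub_mem
        (mul_mem hc (pow_mem (coord_mem 3) M)) (mul_mem (pow_mem (coord_mem 0) N) hb))
        (fun x => by
          simp only [Pi.sub_apply, Pi.mul_apply, Pi.pow_apply]
          have := h x
          rw [hac x] at this
          linear_combination this)
      rcases this with h0 | h0
      · exact absurd (h0 ⟨![1, 0, 0, 0], by simp [p]⟩) (by simp)
      · exact fun x => sub_eq_zero.1 (h0 x)
    obtain ⟨d, hd, hcd⟩ := ih hc hc'
    exact ⟨d, hd, fun x => by rw [hac, hcd]; ring⟩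

/-- A function on the smooth locus that is regular on each of the sets `y i ≠ 0` extends to a
regular function on the conifold. -/
lemma exists_extension (f : SmoothLocus → ℂ)
    (h : ∀ i : Fin 4, ∃ N : ℕ, ∃ a ∈ coordinateRing, ∀ x : SmoothLocus, x.1.1 i ≠ 0 →
      x.1.1 i ^ N * f x = a x.1) :
    ∃ F ∈ coordinateRing, ∀ x : SmoothLocus, f x = F x.1 := by
  -- The extra factor `y i` makes both sides vanish where `y i = 0`, so the identity holds on the
  -- whole smooth locus.
  have h' : ∀ i : Fin 4, ∃ N : ℕ, ∃ a ∈ coordinateRing, ∀ x : SmoothLocus,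
      x.1.1 i ^ (N + 1) * f x = a x.1 := fun i => by
    obtain ⟨N, a, ha, hN⟩ := h i
    refine ⟨N, _, mul_mem (coord_mem i) ha, fun x => ?_⟩
    by_cases hx : x.1.1 i = 0
    · simp [hx]
    · simp only [Pi.mul_apply]
      rw [← hN x hx]; ring
  choose N a ha hN using h'
  -- The two charts y₁ ≠ 0 and y₄ ≠ 0 already suffice to clear the denominator; the other points are
  -- reached afterwards by irreducibility.
  have h03 : ∀ x : Cone, a 0 x * x.1 3 ^ (N 3 + 1) = x.1 0 ^ (N 0 + 1) * a 3 x := by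
    intro x
    by_cases hx : x.1 = 0
    · simp [hx]
    · rw [← hN 0 ⟨x, hx⟩, ← hN 3 ⟨x, hx⟩]; ring
  obtain ⟨c, hc, hac⟩ := exists_eq_coord_pow_mul (ha 0) (ha 3) _ _ h03
  have h0 : ∀ x : SmoothLocus, x.1.1 0 ≠ 0 → f x = c x.1 := fun x hx => by
    have := hN 0 x
    rw [hac] at this
    exact mul_left_cancel₀ (pow_ne_zero _ hx) this
  refine ⟨c, hc, fun x => ?_⟩
  obtain ⟨i, hi⟩ : ∃ i, x.1.1 i ≠ 0 := by
    by_contra! hcon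
    exact x.2 (funext hcon)
  have hz := eq_zero_or_eq_zero_of_mul (coord_mem 0) (sub_mem (ha i)
    (mul_mem (pow_mem (coord_mem i) (N i + 1)) hc)) (fun y => by
      by_cases hy : y.1 0 = 0
      · simp [hy]
      · have hy' : y.1 ≠ 0 := fun h => hy (by simp [h])
        simp only [Pi.sub_apply, Pi.mul_apply, Pi.pow_apply]
        rw [← hN i ⟨y, hy'⟩, h0 ⟨y, hy'⟩ hy]
        ring)
  rcases hz with hz | hz
  · exact absurd (hz ⟨![1, 0, 0, 0], by simp [p]⟩) (by simp)
  · have := sub_eq_zero.1 (hz x.1)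
    rw [← hN i x] at this
    exact mul_left_cancel₀ (pow_ne_zero _ hi) this

end Conifold

namespace Conifold

open MvPolynomial

/-! ## The residue form -/

lemma dp_single (y : V) (i : Fin 4) :
    dp y (Pi.single i 1) = ![y 3, -y 2, -y 1, y 0] i := by
  fin_cases i <;> simp [dp]

lemma exists_dp_eq_one {y : V} (hy : y ≠ 0) : ∃ n, dp y n = 1 := by
  have h : ∃ i, dp y (Pi.single i 1) ≠ 0 := by
    by_contra! h
    refine hy (funext fun i => ?_)
    have h0 := h 0
    have h1 := h 1
    have h2 := h 2
    have h3 := h 3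
    simp only [dp_single] at h0 h1 h2 h3
    fin_cases i <;> simp_all
  obtain ⟨i, hi⟩ := h
  exact ⟨(dp y (Pi.single i 1))⁻¹ • Pi.single i 1, by
    rw [map_smul, smul_eq_mul, inv_mul_cancel₀ hi]⟩

/-- The determinant of four vectors. -/
def det4 : V [⋀^Fin 4]→ₗ[ℂ] ℂ := Matrix.detRowAlternating

/-- Four vectors in the hyperplane ker dp are dependent: the nonzero gradient lies in the kernel of
the matrix with these rows. -/
lemma det4_eq_zero_of_dp {y : V} (hy : y ≠ 0) (w : Fin 4 → V) (hw : ∀ i, dp y (w i) = 0) :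
    det4 w = 0 := by
  change Matrix.det (Matrix.of w) = 0
  rw [← Matrix.exists_mulVec_eq_zero_iff]
  refine ⟨fun i => dp y (Pi.single i 1), fun h => ?_, ?_⟩
  · obtain ⟨n, hn⟩ := exists_dp_eq_one hy
    have : dp y = 0 := by
      refine LinearMap.pi_ext' fun i => LinearMap.ext_ring ?_
      simpa using congrFun h i
    simp [this] at hn
  · ext i
    have := hw i
    simp only [Matrix.mulVec, dotProduct, Matrix.of_apply, dp_single, Fin.sum_univ_four,
      Pi.zero_apply]
    simp only [dp, LinearMap.coe_mk, AddHom.coe_mk] at this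
    simp
    linear_combination this

/-- A vector on which the differential of the equation is one. -/
def normal (x : SmoothLocus) : V := (exists_dp_eq_one x.2).choose

lemma dp_normal (x : SmoothLocus) : dp x.1.1 (normal x) = 1 := (exists_dp_eq_one x.2).choose_spec

/-- The residue of the standard 4-form divided by the equation of the conifold. -/
def residueForm : ThreeForm := fun x =>
  (det4.curryLeft (normal x)).compLinearMap (Tangent x).subtype

/-- Replacing n by its multiple of `normal x` changes it by a tangent vector, on which the
determinant vanishes. This identity characterizes the residue and makes it independent of the chosen
normal vector. -/
lemma dp_mul_residueForm (x : SmoothLocus) (n : V) (v : Fin 3 → Tangent x) :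
    dp x.1.1 n * residueForm x v = det4 (Matrix.vecCons n fun k => (v k : V)) := by
  have h : det4 (Matrix.vecCons (n - dp x.1.1 n • normal x) fun k => (v k : V)) = 0 := by
    refine det4_eq_zero_of_dp x.2 _ fun i => ?_
    refine Fin.cases ?_ (fun k => ?_) i
    · simp [dp_normal]
    · exact (v k).2
  have hc : ∀ m : V, det4 (Matrix.vecCons m fun k => (v k : V))
      = det4.curryLeft m (fun k => (v k : V)) := fun m => rfl
  rw [hc, map_sub, map_smul] at h
  rw [hc]
  exact (sub_eq_zero.1 h).symm

/-- Tangent vector fields that span the tangent spaces on the open set `y i ≠ 0`. -/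
def frame (i : Fin 4) (k : Fin 3) (y : V) : V :=
  dp y (Pi.single (Fin.rev i) 1) • Pi.single ((Fin.rev i).succAbove k) 1
    - dp y (Pi.single ((Fin.rev i).succAbove k) 1) • Pi.single (Fin.rev i) 1

lemma dp_frame (i : Fin 4) (k : Fin 3) (y : V) : dp y (frame i k y) = 0 := by
  simp only [frame, map_sub, map_smul, smul_eq_mul]
  ring

/-- This is why the frame on `y i ≠ 0` singles out the index `Fin.rev i`: the corresponding partial
derivative of the equation is ±`y i`. -/
lemma dp_single_rev (y : V) (i : Fin 4) :
    dp y (Pi.single (Fin.rev i) 1) = ![1, -1, -1, 1] i * y i := by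
  rw [dp_single]
  fin_cases i <;> simp [Fin.rev]

/-- The frame as a family of tangent vectors. -/
def frameAt (i : Fin 4) (x : SmoothLocus) (k : Fin 3) : Tangent x :=
  ⟨frame i k x.1.1, dp_frame i k _⟩

lemma det4_frame (i : Fin 4) (y : V) :
    det4 (Matrix.vecCons (Pi.single (Fin.rev i) 1) fun k => frame i k y)
      = ![-1, -1, 1, 1] i * y i ^ 3 := by
  have h (w : Fin 4 → V) : det4 w = Matrix.det (Matrix.of w) := rfl
  have hv (n : V) (w : Fin 3 → V) : Matrix.vecCons n w = ![n, w 0, w 1, w 2] := by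
    ext a; fin_cases a <;> rfl
  rw [h, hv]
  simp only [frame, dp_single]
  fin_cases i <;>
    simp [Matrix.det_succ_row_zero, Fin.sum_univ_succ, Fin.rev, Fin.succAbove, Pi.single_apply]
      <;> ring

lemma residueForm_frameAt (i : Fin 4) (x : SmoothLocus) (hx : x.1.1 i ≠ 0) :
    residueForm x (frameAt i x) = ![-1, 1, -1, 1] i * x.1.1 i ^ 2 := by
  have h := dp_mul_residueForm x (Pi.single (Fin.rev i) 1) (frameAt i x)
  rw [dp_single_rev] at h
  have h2 := h.trans (det4_frame i x.1.1)
  refine mul_left_cancel₀ hx ?_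
  have e1 : (![1, -1, -1, 1] i : ℂ) * ![1, -1, -1, 1] i = 1 := by fin_cases i <;> simp
  have e2 : (![1, -1, -1, 1] i : ℂ) * ![-1, -1, 1, 1] i = ![-1, 1, -1, 1] i := by
    fin_cases i <;> simp
  linear_combination (![1, -1, -1, 1] i : ℂ) * h2
    - x.1.1 i * residueForm x (frameAt i x) * e1 + x.1.1 i ^ 3 * e2

lemma exists_coord_ne_zero (x : SmoothLocus) : ∃ i, x.1.1 i ≠ 0 := by
  by_contra! h
  exact x.2 (funext h)

lemma residueForm_ne_zero (x : SmoothLocus) : residueForm x ≠ 0 := by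
  obtain ⟨i, hi⟩ := exists_coord_ne_zero x
  intro h
  have h2 := residueForm_frameAt i x hi
  rw [h, AlternatingMap.zero_apply] at h2
  have e : (![-1, 1, -1, 1] i : ℂ) ≠ 0 := by fin_cases i <;> simp
  exact mul_ne_zero e (pow_ne_zero 2 hi) h2.symm

lemma finrank_tangent (x : SmoothLocus) : Module.finrank ℂ (Tangent x) = 3 := by
  have h := LinearMap.finrank_range_add_finrank_ker (dp x.1.1)
  have hr : LinearMap.range (dp x.1.1) = ⊤ := by
    rw [LinearMap.range_eq_top]
    intro c
    exact ⟨c • normal x, by rw [map_smul, dp_normal, smul_eq_mul, mul_one]⟩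
  rw [hr, finrank_top, Module.finrank_self, Module.finrank_fin_fun] at h
  have h' : 1 + Module.finrank ℂ (Tangent x) = 4 := h
  omega

/-- Alternating 3-forms on a three-dimensional space form a line, spanned by the nonzero residue. -/
lemma exists_eq_smul_residueForm (w : ThreeForm) :
    ∃ f : SmoothLocus → ℂ, ∀ x, w x = f x • residueForm x := by
  refine ⟨fun x => (w x (Module.finBasisOfFinrankEq ℂ _ (finrank_tangent x)))
    / residueForm x (Module.finBasisOfFinrankEq ℂ _ (finrank_tangent x)), fun x => ?_⟩
  set b := Module.finBasisOfFinrankEq ℂ _ (finrank_tangent x)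
  have h1 := (w x).eq_smul_basis_det b
  have h2 := (residueForm x).eq_smul_basis_det b
  have h3 : residueForm x b ≠ 0 := fun h0 => by
    rw [h0, zero_smul] at h2
    exact residueForm_ne_zero x h2
  rw [h1, h2, smul_smul]
  rw [div_mul_cancel₀ _ h3]

lemma smul_residueForm_cancel {x : SmoothLocus} {a b : ℂ}
    (h : a • residueForm x = b • residueForm x) : a = b := by
  by_contra hab
  rw [← sub_eq_zero, ← sub_smul] at h
  exact (smul_ne_zero (sub_ne_zero.2 hab) (residueForm_ne_zero x)) h

/-- The product of a function on the conifold and the residue form. -/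
def formOf (f : Cone → ℂ) : ThreeForm := f • residueForm

lemma formOf_apply (f : Cone → ℂ) (x : SmoothLocus) : formOf f x = f x.1 • residueForm x := rfl

lemma det4_eq_sum (n : V) (v : Fin 3 → V) :
    det4 (Matrix.vecCons n v) = ∑ J : Fin 3 → Fin 4,
      det4 (Matrix.vecCons n fun k => Pi.single (J k) 1) * ∏ k, v k (J k) := by
  have h (w : Fin 3 → V) : det4 (Matrix.vecCons n w)
    = (det4.curryLeft n).toMultilinearMap w := rfl
  have hv : v = fun k => ∑ j, v k j • (Pi.single j 1 : V) := by
    ext k i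
    simp [Finset.sum_apply, Pi.single_apply]
  conv_lhs => rw [hv, h, MultilinearMap.map_sum]
  refine Finset.sum_congr rfl fun J _ => ?_
  rw [MultilinearMap.map_smul_univ, smul_eq_mul, mul_comm, h]

lemma isRegularForm_formOf {f : Cone → ℂ} (hf : f ∈ coordinateRing) :
    IsRegularForm (formOf f) := by
  obtain ⟨F, hF⟩ := mem_coordinateRing_iff.1 hf
  intro i
  -- Contracting with the constant vector e of index `Fin.rev i` gives `dp` e = ±`y i`, so one power
  -- of `y i` turns the residue into a tensor with constant coefficients.
  refine ⟨1, fun J => F * C (![1, -1, -1, 1] i *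
    det4 (Matrix.vecCons (Pi.single (Fin.rev i) 1) fun k => Pi.single (J k) 1)),
    fun x _ v => ?_⟩
  have h := dp_mul_residueForm x (Pi.single (Fin.rev i) 1) v
  rw [dp_single_rev, det4_eq_sum] at h
  have e1 : (![1, -1, -1, 1] i : ℂ) * ![1, -1, -1, 1] i = 1 := by fin_cases i <;> simp
  simp only [map_mul, eval_C, mul_assoc]
  rw [← Finset.mul_sum, ← Finset.mul_sum, ← h, formOf_apply, AlternatingMap.smul_apply,
    smul_eq_mul, hF]
  linear_combination (-x.1.1 i * eval x.1.1 F * residueForm x v) * e1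

lemma frame_poly (i : Fin 4) (k : Fin 3) (j : Fin 4) :
    ∃ P : MvPolynomial (Fin 4) ℂ, ∀ y : V, frame i k y j = eval y P := by
  have h : ∀ m : Fin 4, ∃ P : MvPolynomial (Fin 4) ℂ, ∀ y : V,
      dp y (Pi.single m 1) = eval y P := fun m => by
    refine ⟨![X 3, -X 2, -X 1, X 0] m, fun y => ?_⟩
    rw [dp_single]
    fin_cases m <;> simp
  obtain ⟨P, hP⟩ := h (Fin.rev i)
  obtain ⟨Q, hQ⟩ := h ((Fin.rev i).succAbove k)
  refine ⟨P * C ((Pi.single ((Fin.rev i).succAbove k) 1 : V) j)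
    - Q * C ((Pi.single (Fin.rev i) 1 : V) j), fun y => ?_⟩
  simp [frame, hP, hQ]

/-- Every regular form is the product of a regular function and the residue form. -/
lemma IsRegularForm.exists_eq_formOf {w : ThreeForm} (hw : IsRegularForm w) :
    ∃ f ∈ coordinateRing, w = formOf f := by
  obtain ⟨f, hf⟩ := exists_eq_smul_residueForm w
  obtain ⟨F, hF, hfF⟩ := exists_extension f fun i => by
    obtain ⟨N, P, hP⟩ := hw i
    choose Q hQ using frame_poly i
    -- Evaluation on the polynomial frame recovers the coefficient f up to the factor ±(`y i`)²,
    -- which accounts for the 2.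
    refine ⟨N + 2, fun x => eval x.1 (C (![-1, 1, -1, 1] i) *
      ∑ J : Fin 3 → Fin 4, P J * ∏ k, Q k (J k)),
      mem_coordinateRing_iff.2 ⟨_, fun x => rfl⟩, fun x hx => ?_⟩
    have h1 := hP x hx (frameAt i x)
    rw [hf x, AlternatingMap.smul_apply, residueForm_frameAt i x hx] at h1
    have e1 : (![-1, 1, -1, 1] i : ℂ) * ![-1, 1, -1, 1] i = 1 := by fin_cases i <;> simp
    simp only [map_mul, eval_C, map_sum, map_prod, ← hQ]
    change _ = _ * ∑ J, eval x.1.1 (P J) * ∏ k, ((frameAt i x k : V)) (J k)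
    rw [← h1, smul_eq_mul]
    linear_combination (-x.1.1 i ^ (N + 2) * f x) * e1
  refine ⟨F, hF, funext fun x => ?_⟩
  rw [hf x, hfF x]
  rfl

/-! ## The action on the residue form -/

lemma p_single_add_single : p (Pi.single 0 1 + Pi.single 3 1) = 1 := by simp [p]

/-- The factor by which a symmetry multiplies `y₁ y₄ - y₂ y₃`. -/
def multiplier (s : Sym) : ℂ := (exists_multiplier s).choose

lemma p_rep (s : Sym) (y : V) : p (rep s y) = multiplier s * p y :=
  (exists_multiplier s).choose_spec y

lemma multiplier_eq {s : Sym} {c : ℂ} (h : ∀ y, p (rep s y) = c * p y) : multiplier s = c := by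
  have h1 := h (Pi.single 0 1 + Pi.single 3 1)
  rwa [p_rep, p_single_add_single, mul_one, mul_one] at h1

lemma multiplier_mul (s t : Sym) : multiplier (s * t) = multiplier s * multiplier t :=
  multiplier_eq fun y => by rw [map_mul, LinearEquiv.mul_apply, p_rep, p_rep, mul_assoc]

lemma multiplier_one : multiplier 1 = 1 :=
  multiplier_eq fun y => by simp

lemma multiplier_ne_zero (s : Sym) : multiplier s ≠ 0 := fun h => by
  have := multiplier_mul s s⁻¹
  rw [mul_inv_cancel, multiplier_one, h, zero_mul] at this
  exact one_ne_zero this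

lemma dp_rep (s : Sym) (y v : V) : dp (rep s y) (rep s v) = multiplier s * dp y v := by
  have polar : ∀ y w : V, dp y w = p (y + w) - p y - p w := fun y w => by
    simp only [dp, p, LinearMap.coe_mk, AddHom.coe_mk, Pi.add_apply]; ring
  rw [polar, polar, ← map_add, p_rep, p_rep, p_rep]
  ring

lemma det4_rep (s : Sym) (v : Fin 4 → V) :
    det4 (fun i => rep s (v i)) = LinearMap.det (rep s).toLinearMap * det4 v := by
  have h : det4 = (Pi.basisFun ℂ (Fin 4)).det := (Pi.basisFun_det).symm
  rw [h]
  exact Module.Basis.det_comp _ (rep s).toLinearMap v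

/-- The factor by which a symmetry multiplies the residue form. -/
def residueFactor (s : Sym) : ℂ := LinearMap.det (rep s).toLinearMap / multiplier s

lemma residueFactor_mul (s t : Sym) :
    residueFactor (s * t) = residueFactor s * residueFactor t := by
  have h : LinearMap.det (rep (s * t)).toLinearMap
      = LinearMap.det (rep s).toLinearMap * LinearMap.det (rep t).toLinearMap := by
    rw [← LinearMap.det_comp, map_mul]
    rfl
  rw [residueFactor, residueFactor, residueFactor, h, multiplier_mul, div_mul_div_comm]

lemma residueFactor_one : residueFactor 1 = 1 := by
  have h : (rep 1).toLinearMap = LinearMap.id := by rw [map_one]; rfl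
  rw [residueFactor, h, LinearMap.det_id, multiplier_one, div_one]

/-- The linear map scales the 4-form by its determinant and the equation by the multiplier; the
residue is their quotient. -/
lemma residueForm_actSmooth (s : Sym) (x : SmoothLocus) :
    (residueForm (actSmooth s x)).compLinearMap (tangentMap s x)
      = residueFactor s • residueForm x := by
  ext v
  have h1 := dp_mul_residueForm (actSmooth s x) (rep s (normal x)) (fun k => tangentMap s x (v k))
  have h2 := dp_mul_residueForm x (normal x) v
  rw [dp_normal, one_mul] at h2
  have h3 : dp (actSmooth s x).1.1 (rep s (normal x)) = multiplier s := by
    change dp (rep s x.1.1) _ = _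
    rw [dp_rep, dp_normal, mul_one]
  have h4 : (Matrix.vecCons (rep s (normal x)) fun k => (tangentMap s x (v k) : V))
      = fun i => rep s ((Matrix.vecCons (normal x) fun k => (v k : V)) i) := by
    ext1 i
    refine Fin.cases rfl (fun k => rfl) i
  rw [h3, h4, det4_rep, ← h2] at h1
  rw [AlternatingMap.smul_apply, residueFactor, smul_eq_mul, div_mul_eq_mul_div,
    eq_div_iff (multiplier_ne_zero s), mul_comm, ← h1]
  rfl

lemma isInvariantForm_formOf_iff (G : Subgroup Sym) {f : Cone → ℂ} :
    IsInvariantForm G (formOf f) ↔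
      ∀ s ∈ G, ∀ x : SmoothLocus, residueFactor s * f (act s x.1) = f x.1 := by
  refine forall₂_congr fun s _ => forall_congr' fun x => ?_
  have h : (formOf f (actSmooth s x)).compLinearMap (tangentMap s x)
      = (residueFactor s * f (act s x.1)) • residueForm x := by
    rw [mul_comm, mul_smul, ← residueForm_actSmooth]
    rfl
  rw [h, formOf_apply]
  exact ⟨smul_residueForm_cancel, fun h => by rw [h]⟩

lemma mem_canonicalModule_iff (G : Subgroup Sym) (w : ThreeForm) :
    w ∈ canonicalModule G ↔ ∃ f ∈ coordinateRing,
      (∀ s ∈ G, ∀ x : SmoothLocus, residueFactor s * f (act s x.1) = f x.1) ∧ w = formOf f := by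
  constructor
  · rintro ⟨h1, h2⟩
    obtain ⟨f, hf, rfl⟩ := h1.exists_eq_formOf
    exact ⟨f, hf, (isInvariantForm_formOf_iff G).1 h2, rfl⟩
  · rintro ⟨f, hf, h, rfl⟩
    exact ⟨isRegularForm_formOf hf, (isInvariantForm_formOf_iff G).2 h⟩

end Conifold

namespace Conifold

open MvPolynomial

/-! ## The Gorenstein condition -/

lemma eq_zero_of_forall_smoothLocus {f : Cone → ℂ} (hf : f ∈ coordinateRing)
    (h : ∀ x : SmoothLocus, f x.1 = 0) (x : Cone) : f x = 0 := by
  rcases eq_zero_or_eq_zero_of_mul (coord_mem 0) hf (fun y => by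
    by_cases hy : y.1 = 0
    · simp [hy]
    · rw [h ⟨y, hy⟩, mul_zero]) with h0 | h0
  · exact absurd (h0 ⟨![1, 0, 0, 0], by simp [p]⟩) (by simp)
  · exact h0 x

lemma formOf_injective {f g : Cone → ℂ} (hf : f ∈ coordinateRing) (hg : g ∈ coordinateRing)
    (h : formOf f = formOf g) : f = g := by
  funext x
  refine sub_eq_zero.1 (eq_zero_of_forall_smoothLocus (sub_mem hf hg) (fun y => ?_) x)
  exact sub_eq_zero.2 (smul_residueForm_cancel (congrFun h y))

/-- The regular functions that a group of symmetries multiplies by the inverse of a character. -/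
def IsSemiInvariant (G : Subgroup Sym) (ψ : Sym → ℂ) (f : Cone → ℂ) : Prop :=
  f ∈ coordinateRing ∧ ∀ s ∈ G, ∀ x, ψ s * f (act s x) = f x

lemma mem_canonicalModule_iff_exists_isSemiInvariant (G : Subgroup Sym) (w : ThreeForm) :
    w ∈ canonicalModule G ↔ ∃ f, IsSemiInvariant G residueFactor f ∧ w = formOf f := by
  rw [mem_canonicalModule_iff]
  constructor
  · rintro ⟨f, hf, h, hw⟩
    refine ⟨f, ⟨hf, fun s hs x => ?_⟩, hw⟩
    refine sub_eq_zero.1 (eq_zero_of_forall_smoothLocus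
      (sub_mem (mul_mem (const_mem (residueFactor s)) (comp_act_mem hf s)) hf) (fun y => ?_) x)
    exact sub_eq_zero.2 (h s hs y)
  · rintro ⟨f, ⟨hf, h⟩, hw⟩
    exact ⟨f, hf, fun s hs x => h s hs x.1, hw⟩

lemma isSemiInvariant_one_iff {G : Subgroup Sym} {ψ : Sym → ℂ} (h : ∀ s ∈ G, ψ s = 1)
    {f : Cone → ℂ} : IsSemiInvariant G ψ f ↔ f ∈ quotientRing G := by
  refine and_congr_right fun _ => forall₂_congr fun s hs => forall_congr' fun x => ?_
  rw [h s hs, one_mul]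

/-- With trivial character the residue form is itself invariant and is a basis of the module over
the invariants. -/
lemma invertible_canonicalModule (G : Subgroup Sym) (h : ∀ s ∈ G, residueFactor s = 1) :
    Module.Invertible (quotientRing G) (canonicalModule G) := by
  have h1 : formOf 1 ∈ canonicalModule G :=
    (mem_canonicalModule_iff_exists_isSemiInvariant G _).2
      ⟨1, (isSemiInvariant_one_iff h).2 (one_mem _), rfl⟩
  have hsmul : ∀ f : quotientRing G,
      ((f • (⟨formOf 1, h1⟩ : canonicalModule G) : canonicalModule G) : ThreeForm)
        = formOf f.1 := fun f => by
    change f.1 • formOf 1 = _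
    rw [formOf, smul_smul, mul_one]
    rfl
  let e := LinearEquiv.ofBijective
    (LinearMap.toSpanSingleton (quotientRing G) (canonicalModule G) ⟨formOf 1, h1⟩) <| by
      constructor
      · intro f g hfg
        refine Subtype.ext (formOf_injective f.2.1 g.2.1 ?_)
        rw [← hsmul, ← hsmul]
        exact congrArg Subtype.val hfg
      · rintro ⟨w, hw⟩
        obtain ⟨f, hf, rfl⟩ := (mem_canonicalModule_iff_exists_isSemiInvariant G _).1 hw
        exact ⟨⟨f, (isSemiInvariant_one_iff h).1 hf⟩, Subtype.ext (hsmul _)⟩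
  exact Module.Invertible.congr e

/-- A group that acts freely outside of the origin has semi-invariants, for each character, that
do not vanish at a given point. -/
lemma exists_isSemiInvariant (G : Subgroup Sym) [Finite G]
    (hfree : ∀ s ∈ G, s ≠ 1 → ∀ x : Cone, act s x = x → x = origin) (ψ : Sym → ℂ)
    (h1 : ψ 1 = 1) (hmul : ∀ s t, ψ (s * t) = ψ s * ψ t) {x : Cone} (hx : x ≠ origin) :
    ∃ f, IsSemiInvariant G ψ f ∧ f x = 1 := by
  have := Fintype.ofFinite G
  obtain ⟨f, hf, hfx, hfy⟩ := exists_separating x (fun s : {s : G // s ≠ 1} => act s.1.1 x)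
    fun s hs => hx (hfree _ s.1.2 (fun h => s.2 (Subtype.ext h)) x hs)
  -- The average of f twisted by ψ: at x only t = 1 contributes, because f vanishes on the rest of
  -- the orbit.
  refine ⟨fun y => ∑ t : G, ψ t * f (act t y), ⟨?_, fun s hs y => ?_⟩, ?_⟩
  · have : (fun y => ∑ t : G, ψ t * f (act t y))
        = ∑ t : G, (fun _ => ψ t) * fun y => f (act t y) := by
      ext y
      simp [Finset.sum_apply]
    rw [this]
    exact sum_mem fun t _ => mul_mem (const_mem _) (comp_act_mem hf _)
  · dsimp only
    rw [Finset.mul_sum]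
    conv_rhs => rw [← Equiv.sum_comp (Equiv.mulRight (⟨s, hs⟩ : G))]
    refine Finset.sum_congr rfl fun t _ => ?_
    simp only [Equiv.coe_mulRight, Subgroup.coe_mul, act_mul, hmul]
    ring
  · dsimp only
    rw [Finset.sum_eq_single (1 : G)]
    · simp [h1, hfx]
    · intro t _ ht
      rw [hfy ⟨t, ht⟩, mul_zero]
    · simp

/-- A plane curve through the origin has no isolated point there. If U vanished at every other zero
of P, a prime factor q of P through the origin would divide both `X i * U` by the Nullstellensatz;
it does not divide U, so it would divide both coordinates and be a unit. -/
lemma exists_zero_ne_zero (P U : MvPolynomial (Fin 2) ℂ) (hP : eval 0 P = 0)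
    (hU : eval 0 U ≠ 0) : ∃ t : Fin 2 → ℂ, t ≠ 0 ∧ eval t P = 0 ∧ eval t U ≠ 0 := by
  by_contra! hcon
  have hP0 : P ≠ 0 := by
    rintro rfl
    have h : X 0 * U = 0 := MvPolynomial.funext fun t => by
      by_cases ht : t = 0
      · simp [ht]
      · rw [map_mul, hcon t ht (map_zero _), mul_zero, map_zero]
    rcases mul_eq_zero.1 h with h | h
    · exact X_ne_zero _ h
    · exact hU (by rw [h, map_zero])
  obtain ⟨q, hq, hqP, hq0⟩ : ∃ q : MvPolynomial (Fin 2) ℂ, Prime q ∧ q ∣ P ∧ eval 0 q = 0 := by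
    obtain ⟨S, hS, hSP⟩ := UniqueFactorizationMonoid.exists_prime_factors P hP0
    obtain ⟨r, hr⟩ := hSP
    have h0 : eval 0 S.prod = 0 := by
      have h := congrArg (eval 0) hr
      rw [map_mul, hP] at h
      exact (mul_eq_zero.1 h).resolve_right ((r.isUnit.map (eval (0 : Fin 2 → ℂ))).ne_zero)
    rw [map_multiset_prod, Multiset.prod_eq_zero_iff, Multiset.mem_map] at h0
    obtain ⟨q, hqS, hq0⟩ := h0
    exact ⟨q, hS q hqS, (Multiset.dvd_prod hqS).trans ⟨_, hr.symm⟩, hq0⟩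
  have hprime : (Ideal.span {q}).IsPrime := (Ideal.span_singleton_prime hq.ne_zero).2 hq
  have hX : ∀ i : Fin 2, q ∣ X i := fun i => by
    have h : X i * U ∈ Ideal.span {q} := by
      rw [← MvPolynomial.IsPrime.vanishingIdeal_zeroLocus (K := ℂ) (Ideal.span {q}),
        mem_vanishingIdeal_iff]
      intro t ht
      rw [mem_zeroLocus_iff] at ht
      have hqt : eval t q = 0 := by
        simpa using ht q (Ideal.mem_span_singleton_self q)
      have hPt : eval t P = 0 := by
        obtain ⟨c, rfl⟩ := hqP
        rw [map_mul, hqt, zero_mul]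
      by_cases h0 : t = 0
      · simp [h0]
      · have := hcon t h0 hPt
        rw [aeval_eq_eval]
        simp [this]
    refine (hq.dvd_or_dvd (Ideal.mem_span_singleton.1 h)).resolve_right ?_
    rintro ⟨c, rfl⟩
    exact hU (by rw [map_mul, hq0, zero_mul])
  obtain ⟨a, ha⟩ := hX 0
  obtain ⟨b, hb⟩ := hX 1
  have hab : (X 0 : MvPolynomial (Fin 2) ℂ) * b = X 1 * a := by
    rw [ha, hb]; ring
  have hXa : X 0 ∣ a := by
    refine ((X_prime (R := ℂ) (i := (0 : Fin 2))).dvd_or_dvd (a := X 1)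
      ⟨b, hab.symm⟩).resolve_left fun hd => ?_
    rw [X_dvd_X] at hd
    simp at hd
  obtain ⟨c, rfl⟩ := hXa
  have hqc : q * c = 1 := by
    refine mul_left_cancel₀ (X_ne_zero (R := ℂ) (0 : Fin 2)) ?_
    rw [mul_one]
    conv_rhs => rw [ha]
    ring
  have := congrArg (eval 0) hqc
  rw [map_mul, hq0, zero_mul, map_one] at this
  exact zero_ne_one this

/-- A plane that is contained in the conifold. -/
def plane (t : Fin 2 → ℂ) : Cone := ⟨![t 0, t 1, 0, 0], by simp [p]⟩

lemma isPolynomialMap_plane : IsPolynomialMap plane := by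
  intro i
  fin_cases i
  · exact ⟨X 0, fun t => by simp [plane]⟩
  · exact ⟨X 1, fun t => by simp [plane]⟩
  · exact ⟨0, fun t => by simp [plane]⟩
  · exact ⟨0, fun t => by simp [plane]⟩

lemma plane_zero : plane 0 = origin :=
  Subtype.ext (funext fun i => by fin_cases i <;> simp [plane, origin])

lemma plane_eq_origin {t : Fin 2 → ℂ} (h : plane t = origin) : t = 0 := by
  have h0 := congrFun (congrArg Subtype.val h) 0
  have h1 := congrFun (congrArg Subtype.val h) 1
  ext i
  fin_cases i
  · simpa [plane, origin] using h0
  · simpa [plane, origin] using h1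

/-- Evaluation `Dual ⊗ M → A` is onto for an invertible module, so its values on pure tensors cannot
all lie in a proper ideal. -/
lemma exists_dual_apply_ne_zero {A M : Type*} [CommRing A] [AddCommGroup M] [Module A M]
    [Module.Invertible A M] (I : Ideal A) (hI : I ≠ ⊤) :
    ∃ (φ : Module.Dual A M) (m : M), φ m ∉ I := by
  by_contra! h
  obtain ⟨t, ht⟩ := (Module.Invertible.bijective (R := A) (M := M)).2 1
  refine hI ((Ideal.eq_top_iff_one I).2 ?_)
  rw [← ht]
  clear ht
  induction t using TensorProduct.induction_on with
  | zero => simp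
  | tmul φ m => simpa using h φ m
  | add a b ha hb => rw [map_add]; exact add_mem ha hb

/-- A semi-invariant of a nontrivial character vanishes at the origin, which every symmetry fixes.
Invertibility makes one of them, f₀, a generator near the origin, so near the origin all
semi-invariants would vanish along the zero locus of f₀. That locus contains points other than the
origin at which u is nonzero, and there some semi-invariant is 1. -/
lemma residueFactor_eq_one (G : Subgroup Sym) [Finite G]
    (hfree : ∀ s ∈ G, s ≠ 1 → ∀ x : Cone, act s x = x → x = origin)
    (hinv : Module.Invertible (quotientRing G) (canonicalModule G)) :
    ∀ s ∈ G, residueFactor s = 1 := by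
  intro s hs
  by_contra hs1
  obtain ⟨φ, m₀, hφ⟩ := exists_dual_apply_ne_zero (A := quotientRing G) (M := canonicalModule G)
    (maximalIdealAt G origin) (Ideal.IsPrime.ne_top inferInstance)
  obtain ⟨f₀, hf₀, hm₀⟩ := (mem_canonicalModule_iff_exists_isSemiInvariant G _).1 m₀.2
  have hf₀0 : f₀ origin = 0 := by
    have h := hf₀.2 s hs origin
    rw [act_origin] at h
    by_contra h0
    exact hs1 (mul_right_cancel₀ h0 (h.trans (one_mul _).symm))
  set u : Cone → ℂ := (φ m₀).1 with hu
  have hu0 : u origin ≠ 0 := hφ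
  -- a point of the smooth locus where the generator vanishes
  obtain ⟨x, hx, hxf, hxu⟩ : ∃ x : Cone, x ≠ origin ∧ f₀ x = 0 ∧ u x ≠ 0 := by
    obtain ⟨P, hP⟩ := isPolynomialMap_plane.exists_eval hf₀.1
    obtain ⟨U, hU⟩ := isPolynomialMap_plane.exists_eval (φ m₀).2.1
    obtain ⟨t, ht, htP, htU⟩ := exists_zero_ne_zero P U
      (by rw [← hP, plane_zero, hf₀0]) (by rw [← hU, plane_zero]; exact hu0)
    exact ⟨plane t, fun h => ht (plane_eq_origin h), by rw [hP, htP], by rw [hu, hU]; exact htU⟩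
  obtain ⟨f, hf, hfx⟩ := exists_isSemiInvariant G hfree residueFactor residueFactor_one
    residueFactor_mul hx
  obtain ⟨a, ha, hax⟩ := exists_isSemiInvariant G hfree (fun s => (residueFactor s)⁻¹)
    (by rw [residueFactor_one, inv_one]) (fun s t => by rw [residueFactor_mul, mul_inv]) hx
  have hne : ∀ s, residueFactor s ≠ 0 := fun s h => by
    have := residueFactor_mul s s⁻¹
    rw [mul_inv_cancel, residueFactor_one, h, zero_mul] at this
    exact one_ne_zero this
  -- The factor a has the inverse character, so it turns semi-invariants into invariant functions,
  -- which act on the module.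
  have hprod : ∀ f', IsSemiInvariant G residueFactor f' → a * f' ∈ quotientRing G :=
    fun f' hf' => ⟨mul_mem ha.1 hf'.1, fun t ht y => by
      rw [Pi.mul_apply, Pi.mul_apply, ← ha.2 t ht y, ← hf'.2 t ht y]
      field_simp [hne t]⟩
  let m : canonicalModule G :=
    ⟨formOf f, (mem_canonicalModule_iff_exists_isSemiInvariant G _).2 ⟨f, hf, rfl⟩⟩
  -- Both sides are a f f₀ ω. Applying φ and evaluating at x, where f₀ = 0 and a = f = 1, gives u(x)
  -- = 0.
  have hcomm : (⟨a * f₀, hprod f₀ hf₀⟩ : quotientRing G) • m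
      = (⟨a * f, hprod f hf⟩ : quotientRing G) • m₀ := by
    refine Subtype.ext ?_
    change (a * f₀) • formOf f = (a * f) • (m₀ : ThreeForm)
    rw [hm₀, formOf, formOf, smul_smul, smul_smul]
    congr 1
    ring
  have h1 := congrArg φ hcomm
  rw [map_smul, map_smul] at h1
  have h2 := congrFun (congrArg Subtype.val h1) x
  change a x * f₀ x * (φ m).1 x = a x * f x * u x at h2
  rw [hxf, hax, hfx, mul_zero, zero_mul, one_mul, one_mul] at h2
  exact hxu h2.symm

end Conifold

namespace Conifold

open MvPolynomial

/-! ## The invariant ring as a subring of the coordinate ring -/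

/-! ### Subrings with a module retraction. -/

section RetractedSubring

variable {A R : Type*} [CommRing A] [CommRing R]

/-- Ideals are contracted from a ring extension with a module retraction. -/
lemma comap_map_eq_of_retraction (ι : A →+* R) (ρ : R →+ A) (h1 : ∀ a, ρ (ι a) = a)
    (hmul : ∀ r a, ρ (r * ι a) = ρ r * a) (J : Ideal A) : (J.map ι).comap ι = J := by
  refine le_antisymm (fun a ha => ?_) Ideal.le_comap_map
  have key : ∀ f ∈ J.map ι, ∀ r, ρ (r * f) ∈ J := by
    intro f hf
    refine Submodule.span_induction ?_ ?_ ?_ ?_ hf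
    · rintro _ ⟨j, hj, rfl⟩ r
      rw [hmul]
      exact J.mul_mem_left _ hj
    · intro r
      simp
    · intro f g _ _ hf hg r
      rw [mul_add, map_add]
      exact J.add_mem (hf r) (hg r)
    · intro c f _ hf r
      rw [smul_eq_mul, ← mul_assoc]
      exact hf _
  have := key _ ha 1
  rwa [one_mul, h1] at this

/-- Extension of ideals has contraction as a left inverse, hence is strictly monotone, and an
ascending chain in A gives one in R. -/
lemma isNoetherianRing_of_retraction [IsNoetherianRing R] (ι : A →+* R) (ρ : R →+ A)
    (h1 : ∀ a, ρ (ι a) = a) (hmul : ∀ r a, ρ (r * ι a) = ρ r * a) : IsNoetherianRing A := by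
  rw [isNoetherianRing_iff, isNoetherian_iff']
  have hR : WellFoundedGT (Ideal R) := isNoetherian_iff'.1 ‹IsNoetherianRing R›
  have hmono : StrictMono (Ideal.map ι) :=
    Monotone.strictMono_of_injective (fun _ _ h => Ideal.map_mono h)
      (Function.LeftInverse.injective (g := Ideal.comap ι)
        (comap_map_eq_of_retraction ι ρ h1 hmul))
  exact hmono.wellFoundedGT

end RetractedSubring

/-! ### Generators of the maximal ideal of a localization. -/

section LocalGenerators

variable {A : Type*} [CommRing A] (m : Ideal A) [m.IsPrime]

lemma spanFinrank_maximalIdeal_le {ι : Type*} [Fintype ι] (T : ι → A) (hT : ∀ i, T i ∈ m)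
    (h : ∀ a ∈ m, ∃ v ∉ m, v * a ∈ Ideal.span (Set.range T)) :
    (IsLocalRing.maximalIdeal (Localization.AtPrime m)).spanFinrank ≤ Fintype.card ι := by
  have hspan : IsLocalRing.maximalIdeal (Localization.AtPrime m)
      = Ideal.span (Set.range fun i => algebraMap A (Localization.AtPrime m) (T i)) := by
    rw [← Localization.AtPrime.map_eq_maximalIdeal]
    apply le_antisymm
    · rw [Ideal.map_le_iff_le_comap]
      intro a ha
      obtain ⟨v, hv, hva⟩ := h a ha
      have hu : IsUnit (algebraMap A (Localization.AtPrime m) v) :=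
        IsLocalization.map_units (M := m.primeCompl) _ ⟨v, hv⟩
      have h1 := Ideal.mem_map_of_mem (algebraMap A (Localization.AtPrime m)) hva
      rw [Ideal.map_span, ← Set.range_comp, map_mul] at h1
      exact (Ideal.unit_mul_mem_iff_mem _ hu).1 h1
    · rw [Ideal.span_le]
      rintro _ ⟨i, rfl⟩
      exact Ideal.mem_map_of_mem _ (hT i)
  rw [hspan]
  refine (Submodule.spanFinrank_span_le_ncard_of_finite (Set.finite_range _)).trans ?_
  rw [← Set.image_univ]
  refine (Set.ncard_image_le Set.finite_univ).trans ?_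
  rw [Set.ncard_univ, Nat.card_eq_fintype_card]

/-- The maximal ideal needs no more generators than the family T has members, and this number is at
most the height. -/
lemma isRegularLocalRing_of_generators [IsNoetherianRing A] {ι : Type*} [Fintype ι] (T : ι → A)
    (hT : ∀ i, T i ∈ m) (h : ∀ a ∈ m, ∃ v ∉ m, v * a ∈ Ideal.span (Set.range T))
    (hm : (Fintype.card ι : ℕ∞) ≤ m.height) :
    IsRegularLocalRing (Localization.AtPrime m) := by
  have : IsNoetherianRing (Localization.AtPrime m) :=
    IsLocalization.isNoetherianRing m.primeCompl _ inferInstance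
  refine IsRegularLocalRing.of_spanFinrank_maximalIdeal_le (R := Localization.AtPrime m) ?_
  rw [IsLocalization.AtPrime.ringKrullDim_eq_height m]
  have h1 := spanFinrank_maximalIdeal_le m T hT h
  have h2 : ((IsLocalRing.maximalIdeal (Localization.AtPrime m)).spanFinrank : ℕ∞) ≤ m.height :=
    le_trans (by exact_mod_cast h1) hm
  exact_mod_cast h2

end LocalGenerators

/-! ### Integrality, averaging and Noetherianity for the invariants. -/

lemma quotientRing_le (G : Subgroup Sym) : quotientRing G ≤ coordinateRing := fun _ h => h.1

/-- The inclusion of the invariant functions into the regular functions. -/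
def incl (G : Subgroup Sym) : quotientRing G →ₐ[ℂ] coordinateRing :=
  Subalgebra.inclusion (quotientRing_le G)

instance (G : Subgroup Sym) : Algebra (quotientRing G) coordinateRing :=
  (incl G).toRingHom.toAlgebra

instance : IsNoetherianRing coordinateRing := AlgHom.isNoetherianRing_range _

/-- Composition of regular functions with a symmetry. -/
def pullback (s : Sym) : coordinateRing →ₐ[ℂ] coordinateRing where
  toFun f := ⟨fun x => f.1 (act s x), comp_act_mem f.2 s⟩
  map_one' := rfl
  map_mul' _ _ := rfl
  map_zero' := rfl
  map_add' _ _ := rfl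
  commutes' _ := rfl

lemma pullback_apply (s : Sym) (f : coordinateRing) (x : Cone) :
    (pullback s f).1 x = f.1 (act s x) := rfl

lemma pullback_mul (s t : Sym) (f : coordinateRing) :
    pullback (s * t) f = pullback t (pullback s f) :=
  Subtype.ext (funext fun x => by simp only [pullback_apply, act_mul])

lemma pullback_one (f : coordinateRing) : pullback 1 f = f :=
  Subtype.ext (funext fun x => by simp only [pullback_apply, act_one])

lemma sum_apply_coordinateRing {ι : Type*} (S : Finset ι) (f : ι → coordinateRing) (x : Cone) :
    (∑ i ∈ S, f i).1 x = ∑ i ∈ S, (f i).1 x := by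
  rw [AddSubmonoidClass.coe_finsetSum, Finset.sum_apply]

lemma prod_apply_coordinateRing {ι : Type*} (S : Finset ι) (f : ι → coordinateRing) (x : Cone) :
    (∏ i ∈ S, f i).1 x = ∏ i ∈ S, (f i).1 x := by
  rw [SubmonoidClass.coe_finsetProd, Finset.prod_apply]

/-- The action of a group of symmetries on the regular functions. -/
abbrev pullbackAction (G : Subgroup Sym) : MulSemiringAction G coordinateRing where
  smul s f := pullback (s⁻¹ : G) f
  one_smul f := by
    change pullback ((1⁻¹ : G) : Sym) f = f
    rw [inv_one]
    exact pullback_one f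
  mul_smul s t f := by
    change pullback (((s * t)⁻¹ : G) : Sym) f = pullback _ (pullback _ f)
    rw [mul_inv_rev, Subgroup.coe_mul, pullback_mul]
  smul_zero s := map_zero (pullback (s⁻¹ : G))
  smul_add s := map_add (pullback (s⁻¹ : G))
  smul_one s := map_one (pullback (s⁻¹ : G))
  smul_mul s := map_mul (pullback (s⁻¹ : G))

variable (G : Subgroup Sym)

instance isIntegral_coordinateRing [Finite G] :
    Algebra.IsIntegral (quotientRing G) coordinateRing := by
  let := pullbackAction G
  have : Algebra.IsInvariant (quotientRing G) coordinateRing G := ⟨fun f hf => by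
    refine ⟨⟨f.1, f.2, fun s hs x => ?_⟩, Subtype.ext rfl⟩
    have h : pullback (((⟨s, hs⟩ : G)⁻¹)⁻¹ : G) f = f := hf (⟨s, hs⟩⁻¹)
    rw [inv_inv] at h
    exact congrFun (congrArg Subtype.val h) x⟩
  exact Algebra.IsInvariant.isIntegral (quotientRing G) coordinateRing G

/-- The sum of the translates of a regular function. -/
def traceFun [Fintype G] (f : coordinateRing) : quotientRing G :=
  ⟨(∑ s : G, pullback s f).1, (∑ s : G, pullback s f).2, fun t ht x => by
    rw [sum_apply_coordinateRing, sum_apply_coordinateRing]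
    conv_rhs => rw [← Equiv.sum_comp (Equiv.mulRight (⟨t, ht⟩ : G))]
    refine Finset.sum_congr rfl fun s _ => ?_
    simp only [pullback_apply, ← act_mul]
    rfl⟩

/-- The product of the translates of a regular function. -/
def normFun [Fintype G] (f : coordinateRing) : quotientRing G :=
  ⟨(∏ s : G, pullback s f).1, (∏ s : G, pullback s f).2, fun t ht x => by
    rw [prod_apply_coordinateRing, prod_apply_coordinateRing]
    conv_rhs => rw [← Equiv.prod_comp (Equiv.mulRight (⟨t, ht⟩ : G))]
    refine Finset.prod_congr rfl fun s _ => ?_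
    simp only [pullback_apply, ← act_mul]
    rfl⟩

lemma incl_traceFun [Fintype G] (f : coordinateRing) :
    incl G (traceFun G f) = ∑ s : G, pullback s f := rfl

lemma incl_normFun [Fintype G] (f : coordinateRing) :
    incl G (normFun G f) = ∏ s : G, pullback s f := rfl

lemma pullback_incl {s : Sym} (hs : s ∈ G) (a : quotientRing G) :
    pullback s (incl G a) = incl G a :=
  Subtype.ext (funext fun x => a.2.2 s hs x)

lemma incl_injective : Function.Injective (incl G) := Subalgebra.inclusion_injective _

/-- The average of the translates of a regular function. -/
def reynolds [Fintype G] : coordinateRing →+ quotientRing G where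
  toFun f := (Fintype.card G : ℂ)⁻¹ • traceFun G f
  map_zero' := by
    have h : traceFun G 0 = 0 := incl_injective G (by simp [incl_traceFun])
    rw [h, smul_zero]
  map_add' f g := by
    have h : traceFun G (f + g) = traceFun G f + traceFun G g := incl_injective G (by
      simp only [map_add, incl_traceFun, Finset.sum_add_distrib])
    rw [h, smul_add]

lemma reynolds_mul_incl [Fintype G] (f : coordinateRing) (a : quotientRing G) :
    reynolds G (f * incl G a) = reynolds G f * a := by
  have h : traceFun G (f * incl G a) = traceFun G f * a := incl_injective G (by
    rw [map_mul, incl_traceFun, incl_traceFun, Finset.sum_mul]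
    exact Finset.sum_congr rfl fun s _ => by rw [map_mul, pullback_incl G s.2])
  change (Fintype.card G : ℂ)⁻¹ • traceFun G (f * incl G a)
    = (Fintype.card G : ℂ)⁻¹ • traceFun G f * a
  rw [h, smul_mul_assoc]

lemma reynolds_incl [Fintype G] (a : quotientRing G) : reynolds G (incl G a) = a := by
  rw [← one_mul (incl G a), reynolds_mul_incl]
  have h : traceFun G 1 = (Fintype.card G : ℂ) • 1 := incl_injective G (by
    rw [incl_traceFun, map_smul]
    simp [← Nat.cast_smul_eq_nsmul ℂ, Algebra.smul_def])
  change ((Fintype.card G : ℂ)⁻¹ • traceFun G 1) * a = a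
  rw [h, smul_smul, inv_mul_cancel₀ (Nat.cast_ne_zero.2 Fintype.card_ne_zero), one_smul, one_mul]

lemma comap_map_incl [Finite G] (J : Ideal (quotientRing G)) :
    (J.map (incl G).toRingHom).comap (incl G).toRingHom = J :=
  have := Fintype.ofFinite G
  comap_map_eq_of_retraction _ (reynolds G) (reynolds_incl G) (reynolds_mul_incl G) J

instance isNoetherianRing_quotientRing [Finite G] : IsNoetherianRing (quotientRing G) :=
  have := Fintype.ofFinite G
  isNoetherianRing_of_retraction (incl G).toRingHom (reynolds G) (reynolds_incl G)
    (reynolds_mul_incl G)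

/-! ## Heights of maximal ideals -/

/-- The ideal of the regular functions that vanish on a set. -/
def vanishing (S : Set Cone) : Ideal coordinateRing where
  carrier := {f | ∀ x ∈ S, f.1 x = 0}
  zero_mem' _ _ := rfl
  add_mem' {f g} hf hg x hx := by
    change f.1 x + g.1 x = 0
    rw [hf x hx, hg x hx, add_zero]
  smul_mem' c f hf x hx := by
    change c.1 x * f.1 x = 0
    rw [hf x hx, mul_zero]

lemma mem_vanishing_iff {S : Set Cone} {f : coordinateRing} :
    f ∈ vanishing S ↔ ∀ x ∈ S, f.1 x = 0 := Iff.rfl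

lemma isPrime_vanishing_range {σ : Type*} {φ : (σ → ℂ) → Cone} (hφ : IsPolynomialMap φ) :
    (vanishing (Set.range φ)).IsPrime where
  ne_top' h := by
    have h1 := mem_vanishing_iff.1 ((Ideal.eq_top_iff_one _).1 h) (φ 0) ⟨0, rfl⟩
    exact one_ne_zero h1
  mem_or_mem' {f g} h := by
    simp only [mem_vanishing_iff, Set.forall_mem_range] at h ⊢
    exact hφ.eq_zero_or f.2 g.2 h

instance isPrime_vanishing_singleton (x : Cone) : (vanishing {x}).IsPrime := by
  have h := isPrime_vanishing_range (σ := Fin 0) (φ := fun _ => x)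
    (fun i => ⟨C (x.1 i), fun t => by simp⟩)
  rwa [Set.range_const] at h

lemma comap_vanishing_singleton (x : Cone) :
    (vanishing {x}).comap (algebraMap (quotientRing G) coordinateRing) = maximalIdealAt G x := by
  ext f
  simp only [Ideal.mem_comap, mem_vanishing_iff, Set.mem_singleton_iff, forall_eq]
  rfl

lemma vanishing_lt {S T : Set Cone} (h : S ⊆ T) (f : coordinateRing) (hf : ∀ x ∈ S, f.1 x = 0)
    {y : Cone} (hy : y ∈ T) (hfy : f.1 y ≠ 0) : vanishing T < vanishing S :=
  SetLike.lt_iff_le_and_exists.2 ⟨fun _ hg x hx => hg x (h hx), f, hf, fun hfT => hfy (hfT y hy)⟩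

/-- Incomparability for the integral extension of the invariants: strict inclusions of primes stay
strict after contraction. -/
lemma height_comap_add_one_le [Finite G] {I J : Ideal coordinateRing} [I.IsPrime] [J.IsPrime] (h : I < J) :
    (I.comap (algebraMap (quotientRing G) coordinateRing)).height + 1
      ≤ (J.comap (algebraMap (quotientRing G) coordinateRing)).height :=
  Ideal.height_add_one_le_of_lt_of_isPrime (Ideal.IsIntegral.comap_lt_comap h)

/-- The `i`-th coordinate, as an element of the coordinate ring. -/
def coord (i : Fin 4) : coordinateRing := ⟨fun x => x.1 i, coord_mem i⟩

lemma coord_apply (i : Fin 4) (x : Cone) : (coord i).1 x = x.1 i := rfl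

lemma segre_ne_origin {z : Fin 4 → ℂ} (h : segre z ≠ origin) :
    (z 0 ≠ 0 ∨ z 1 ≠ 0) ∧ (z 2 ≠ 0 ∨ z 3 ≠ 0) := by
  constructor
  all_goals
    by_contra! hc
    refine h (Subtype.ext (funext fun i => ?_))
    fin_cases i <;> simp [segre, origin, hc]

/-- The chain of irreducible sets is: the point, the line joining it to the origin, a plane of the
ruling that contains this line, the whole conifold. Their vanishing ideals are prime and contract to
a strict chain of primes in the invariants. -/
lemma three_le_height [Finite G] (x : Cone) (hx : x ≠ origin) : 3 ≤ (maximalIdealAt G x).height := by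
  obtain ⟨z, rfl⟩ := segre_surjective x
  obtain ⟨h01, h23⟩ := segre_ne_origin hx
  have hval : ∀ a : Fin 4 → ℂ, (segre a).1 = ![a 0 * a 2, a 0 * a 3, a 1 * a 2, a 1 * a 3] :=
    fun _ => rfl
  let line : (Fin 1 → ℂ) → Cone := fun t => segre ![t 0 * z 0, t 0 * z 1, z 2, z 3]
  let ruling : (Fin 2 → ℂ) → Cone := fun t => segre ![t 0, t 1, z 2, z 3]
  have hcomp : ∀ {σ : Type} (g : (σ → ℂ) → Fin 4 → ℂ)
      (_ : ∀ i, ∃ P : MvPolynomial σ ℂ, ∀ t, g t i = eval t P),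
      IsPolynomialMap fun t => segre (g t) := by
    intro σ g hg i
    choose P hP using hg
    fin_cases i
    · exact ⟨P 0 * P 2, fun t => by simp [segre, hP]⟩
    · exact ⟨P 0 * P 3, fun t => by simp [segre, hP]⟩
    · exact ⟨P 1 * P 2, fun t => by simp [segre, hP]⟩
    · exact ⟨P 1 * P 3, fun t => by simp [segre, hP]⟩
  have hline : IsPolynomialMap line := hcomp _ fun i => by
    refine ⟨![X 0 * C (z 0), X 0 * C (z 1), C (z 2), C (z 3)] i, fun t => ?_⟩
    fin_cases i <;> simp
  have hruling : IsPolynomialMap ruling := hcomp _ fun i => by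
    refine ⟨![X 0, X 1, C (z 2), C (z 3)] i, fun t => ?_⟩
    fin_cases i <;> simp
  have := isPrime_vanishing_range hline
  have := isPrime_vanishing_range hruling
  have := isPrime_vanishing_range isPolynomialMap_segre
  have h1 : vanishing (Set.range segre) < vanishing (Set.range ruling) := by
    have hsub : Set.range ruling ⊆ Set.range segre := by
      rintro _ ⟨t, rfl⟩
      exact ⟨_, rfl⟩
    -- The row (a, b) is not proportional to (z₃, z₄), so it gives a point off the plane.
    have hne : ∃ a b : ℂ, a * z 3 - b * z 2 ≠ 0 := by
      rcases h23 with h | h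
      · exact ⟨0, -1, by simpa using h⟩
      · exact ⟨1, 0, by simpa using h⟩
    obtain ⟨a, b, hab⟩ := hne
    refine vanishing_lt hsub ⟨fun x => z 3 * x.1 0 - z 2 * x.1 1,
      sub_mem (mul_mem (const_mem _) (coord_mem 0)) (mul_mem (const_mem _) (coord_mem 1))⟩ ?_
      (y := segre ![1, 0, a, b]) ⟨_, rfl⟩ ?_
    · rintro _ ⟨t, rfl⟩
      simp [ruling, hval]
      ring
    · simp only [hval]
      simpa [mul_comm] using hab
  have h2 : vanishing (Set.range ruling) < vanishing (Set.range line) := by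
    have hsub : Set.range line ⊆ Set.range ruling := by
      rintro _ ⟨t, rfl⟩
      exact ⟨![t 0 * z 0, t 0 * z 1], rfl⟩
    have hne : ∃ a b : ℂ, a * z 1 - b * z 0 ≠ 0 := by
      rcases h01 with h | h
      · exact ⟨0, -1, by simpa using h⟩
      · exact ⟨1, 0, by simpa using h⟩
    obtain ⟨a, b, hab⟩ := hne
    rcases h23 with h | h
    · refine vanishing_lt hsub ⟨fun x => z 1 * x.1 0 - z 0 * x.1 2,
        sub_mem (mul_mem (const_mem _) (coord_mem 0)) (mul_mem (const_mem _) (coord_mem 2))⟩ ?_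
        (y := ruling ![a, b]) ⟨_, rfl⟩ ?_
      · rintro _ ⟨t, rfl⟩
        simp [line, hval]
        ring
      · have : (a * z 1 - b * z 0) * z 2 ≠ 0 := mul_ne_zero hab h
        simp only [ruling, hval]
        convert! this using 1
        simp
        ring
    · refine vanishing_lt hsub ⟨fun x => z 1 * x.1 1 - z 0 * x.1 3,
        sub_mem (mul_mem (const_mem _) (coord_mem 1)) (mul_mem (const_mem _) (coord_mem 3))⟩ ?_
        (y := ruling ![a, b]) ⟨_, rfl⟩ ?_
      · rintro _ ⟨t, rfl⟩
        simp [line, hval]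
        ring
      · have : (a * z 1 - b * z 0) * z 3 ≠ 0 := mul_ne_zero hab h
        simp only [ruling, hval]
        convert! this using 1
        simp
        ring
  have h3 : vanishing (Set.range line) < vanishing {segre z} := by
    have hsub : {segre z} ⊆ Set.range line := by
      rw [Set.singleton_subset_iff]
      refine ⟨fun _ => 1, congrArg segre ?_⟩
      ext i
      fin_cases i <;> simp
    obtain ⟨i, hi⟩ : ∃ i, (segre z).1 i ≠ 0 := by
      by_contra! hc
      exact hx (Subtype.ext (funext hc))
    refine vanishing_lt hsub ⟨fun x => x.1 i - (segre z).1 i,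
      sub_mem (coord_mem i) (const_mem _)⟩ ?_ (y := line 0) ⟨_, rfl⟩ ?_
    · simp
    · have : (line 0).1 i = 0 := by
        fin_cases i <;> simp [line, hval]
      simpa [this] using hi
  have e1 := height_comap_add_one_le G h1
  have e2 := height_comap_add_one_le G h2
  have e3 := height_comap_add_one_le G h3
  rw [comap_vanishing_singleton] at e3
  calc (3 : ℕ∞) = 0 + 1 + 1 + 1 := by norm_num
    _ ≤ _ := by gcongr; exact zero_le
    _ ≤ _ := add_le_add_left (add_le_add_left e1 1) 1
    _ ≤ _ := add_le_add_left e2 1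
    _ ≤ _ := e3

end Conifold

namespace Conifold

open MvPolynomial

/-! ## Smoothness of the quotient outside of the origin -/

/-- The `j`-th coordinate, shifted so that it vanishes at `x`. -/
def shifted (x : Cone) (j : Fin 4) : coordinateRing :=
  ⟨fun y => y.1 j - x.1 j, sub_mem (coord_mem j) (const_mem _)⟩

lemma shifted_apply (x : Cone) (j : Fin 4) (y : Cone) : (shifted x j).1 y = y.1 j - x.1 j := rfl

/-- The maximal ideal of a point is generated by the shifted coordinates: modulo these, a polynomial
equals its value. -/
lemma exists_eq_sum_mul_shifted {x : Cone} {f : coordinateRing} (hf : f.1 x = 0) :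
    ∃ a : Fin 4 → coordinateRing, f = ∑ j, a j * shifted x j := by
  obtain ⟨F, hF⟩ := mem_coordinateRing_iff.1 f.2
  have hmem : F - C (eval x.1 F) ∈ Ideal.span (Set.range fun j => X j - C (x.1 j)) := by
    rw [← Ideal.Quotient.eq_zero_iff_mem]
    set I := Ideal.span (Set.range fun j => (X j - C (x.1 j) : MvPolynomial (Fin 4) ℂ))
    let q := Ideal.Quotient.mkₐ ℂ I
    have h1 : q = (Algebra.ofId ℂ (MvPolynomial (Fin 4) ℂ ⧸ I)).comp (aeval x.1) := by
      refine MvPolynomial.algHom_ext fun j => ?_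
      rw [AlgHom.comp_apply, aeval_X]
      refine (Ideal.Quotient.eq (x := X j) (y := C (x.1 j))).2
        (Ideal.subset_span ⟨j, rfl⟩)
    change q (F - C (eval x.1 F)) = 0
    rw [map_sub, sub_eq_zero]
    have h2 := DFunLike.congr_fun h1 F
    rw [AlgHom.comp_apply, aeval_eq_eval] at h2
    exact h2
  obtain ⟨a, ha⟩ := (Ideal.mem_span_range_iff_exists_fun).1 hmem
  refine ⟨fun j => ⟨fun y => eval y.1 (a j), mem_coordinateRing_iff.2 ⟨a j, fun _ => rfl⟩⟩,
    Subtype.ext (funext fun y => ?_)⟩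
  have h3 := congrArg (eval y.1) ha
  rw [sum_apply_coordinateRing, hF]
  have hx : eval x.1 F = 0 := by rw [← hF, hf]
  simp only [map_sum, map_mul, map_sub, eval_X, eval_C, hx, sub_zero] at h3
  exact h3.symm

/-- The Taylor expansion of the equation at x. Modulo squares it is a linear relation, which makes
one of the four shifted coordinates redundant at a smooth point. -/
lemma sum_dp_mul_shifted (x : Cone) :
    ∑ j, algebraMap ℂ coordinateRing (dp x.1 (Pi.single j 1)) * shifted x j
      = shifted x 1 * shifted x 2 - shifted x 0 * shifted x 3 := by
  refine Subtype.ext (funext fun y => ?_)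
  rw [sum_apply_coordinateRing]
  have hx : x.1 0 * x.1 3 - x.1 1 * x.1 2 = 0 := x.2
  have hy : y.1 0 * y.1 3 - y.1 1 * y.1 2 = 0 := y.2
  change ∑ j, dp x.1 (Pi.single j 1) * (y.1 j - x.1 j)
    = (y.1 1 - x.1 1) * (y.1 2 - x.1 2) - (y.1 0 - x.1 0) * (y.1 3 - x.1 3)
  simp only [dp_single, Fin.sum_univ_four]
  simp
  linear_combination hy - hx

variable (G : Subgroup Sym)

/-- The orbit of a point. -/
def orbit (x : Cone) : Set Cone := Set.range fun s : G => act s x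

lemma mem_vanishing_orbit {x : Cone} {f : coordinateRing} :
    f ∈ vanishing (orbit G x) ↔ ∀ s ∈ G, f.1 (act s x) = 0 := by
  simp [mem_vanishing_iff, orbit]

lemma pullback_mem_vanishing_orbit {x : Cone} {f : coordinateRing}
    (hf : f ∈ vanishing (orbit G x)) {s : Sym} (hs : s ∈ G) :
    pullback s f ∈ vanishing (orbit G x) := by
  rw [mem_vanishing_orbit] at hf ⊢
  intro t ht
  rw [pullback_apply, ← act_mul]
  exact hf _ (mul_mem hs ht)

/-- Invariant functions that form a system of local coordinates, up to one redundant member,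
at the image of `x`, if `ε` is one at `x` and zero on the rest of the orbit. -/
def localCoord [Fintype G] (x : Cone) (ε : coordinateRing) (j : Fin 4) : quotientRing G :=
  traceFun G (shifted x j * ε ^ 2)

lemma shifted_mul_mem_vanishing_orbit {x : Cone} {ε : coordinateRing}
    (hε0 : ∀ s ∈ G, s ≠ 1 → ε.1 (act s x) = 0) (j : Fin 4) :
    shifted x j * ε ∈ vanishing (orbit G x) := by
  rw [mem_vanishing_orbit]
  intro s hs
  change ((act s x).1 j - x.1 j) * ε.1 (act s x) = 0
  by_cases h : s = 1
  · rw [h, act_one, sub_self, zero_mul]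
  · rw [hε0 s hs h, mul_zero]

/-- The hypothesis of Nakayama for the ideal I of the orbit: three invariant functions generate I
modulo I². The translates of ε are orthogonal idempotents modulo I with sum 1, so the claim can be
checked at one point of the orbit at a time. -/
lemma vanishing_orbit_le [Fintype G] (x : Cone) (ε : coordinateRing) (hε : ε.1 x = 1)
    (hε0 : ∀ s ∈ G, s ≠ 1 → ε.1 (act s x) = 0) (j₀ : Fin 4)
    (hj₀ : dp x.1 (Pi.single j₀ 1) ≠ 0) :
    vanishing (orbit G x) ≤ (Ideal.span (Set.range fun j : {j // j ≠ j₀} =>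
      localCoord G x ε j)).map (incl G).toRingHom ⊔
        vanishing (orbit G x) * vanishing (orbit G x) := by
  classical
  set I := vanishing (orbit G x) with hI
  set J := (Ideal.span (Set.range fun j : {j // j ≠ j₀} => localCoord G x ε j)).map
    (incl G).toRingHom
  have hIm : ∀ f : coordinateRing, f ∈ I ↔ ∀ s ∈ G, f.1 (act s x) = 0 :=
    fun f => mem_vanishing_orbit G
  have hεs : ∀ s : G, ∀ t ∈ G, (pullback s ε).1 (act t x) = if (s : Sym) * t = 1 then 1 else 0 := by
    intro s t ht
    rw [pullback_apply, ← act_mul]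
    split_ifs with h
    · rw [h, act_one, hε]
    · exact hε0 _ (mul_mem s.2 ht) h
  -- products of values on the orbit
  have hlin : ∀ j, shifted x j * ε ∈ I := shifted_mul_mem_vanishing_orbit G hε0
  have horth : ∀ s t : G, s ≠ t → pullback s ε * pullback t ε ∈ I := fun s t hst =>
    (hIm _).2 fun r hr => by
      change (pullback s ε).1 (act r x) * (pullback t ε).1 (act r x) = 0
      rw [hεs s r hr, hεs t r hr]
      split_ifs with h1 h2
      · exact absurd (Subtype.ext (mul_right_cancel (h1.trans h2.symm))) hst
      all_goals simp
  have hidem : ε ^ 2 - ε ∈ I := (hIm _).2 fun r hr => by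
    change ε.1 (act r x) ^ 2 - ε.1 (act r x) = 0
    by_cases h : r = 1
    · rw [h, act_one, hε]; ring
    · rw [hε0 r hr h]; ring
  have hsum : 1 - ∑ s : G, pullback s ε ∈ I := (hIm _).2 fun r hr => by
    change 1 - (∑ s : G, pullback s ε).1 (act r x) = 0
    rw [sum_apply_coordinateRing, Finset.sum_eq_single (⟨r, hr⟩⁻¹ : G)]
    · rw [hεs _ r hr]; simp
    · intro s _ hs
      rw [hεs s r hr, if_neg]
      intro h
      exact hs (eq_inv_of_mul_eq_one_left (Subtype.ext h))
    · simp
  have hpb : ∀ (s : G) {f}, f ∈ I → pullback s f ∈ I := fun s f hf =>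
    pullback_mem_vanishing_orbit G hf s.2
  have hsq : ∀ {f g}, f ∈ I → g ∈ I → f * g ∈ J ⊔ I * I := fun hf hg =>
    Ideal.mem_sup_right (Ideal.mul_mem_mul hf hg)
  have hcoord : ∀ (s : G) (j : Fin 4), j ≠ j₀ →
      pullback s (shifted x j * ε ^ 2) ∈ J ⊔ I * I := by
    intro s j hj
    have hJ : incl G (localCoord G x ε j) ∈ J :=
      Ideal.mem_map_of_mem _ (Ideal.subset_span ⟨⟨j, hj⟩, rfl⟩)
    have h1 : pullback s ε * incl G (localCoord G x ε j) ∈ J ⊔ I * I :=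
      Ideal.mem_sup_left (J.mul_mem_left _ hJ)
    -- Multiplication by the translate of ε picks a single summand of the trace; the remaining terms
    -- are products of two elements of I.
    have h2 : pullback s ε * incl G (localCoord G x ε j) = pullback s (shifted x j * ε ^ 2)
        + pullback s (ε ^ 2 - ε) * pullback s (shifted x j * ε)
        + ∑ t ∈ Finset.univ.erase s,
          (pullback s ε * pullback t ε) * pullback t (shifted x j * ε) := by
      rw [localCoord, incl_traceFun, Finset.mul_sum, ← Finset.add_sum_erase _ _ (Finset.mem_univ s)]
      congr 1
      · simp only [map_mul, map_pow, map_sub]; ring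
      · refine Finset.sum_congr rfl fun t _ => ?_
        simp only [map_mul, map_pow]; ring
    have h3 : ∑ t ∈ Finset.univ.erase s,
        (pullback s ε * pullback t ε) * pullback t (shifted x j * ε) ∈ J ⊔ I * I :=
      sum_mem fun t ht => hsq (horth s t (Finset.ne_of_mem_erase ht).symm) (hpb t (hlin j))
    have h4 : pullback s (shifted x j * ε ^ 2) = pullback s ε * incl G (localCoord G x ε j)
        - pullback s (ε ^ 2 - ε) * pullback s (shifted x j * ε)
        - ∑ t ∈ Finset.univ.erase s,
          (pullback s ε * pullback t ε) * pullback t (shifted x j * ε) := by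
      rw [h2]; ring
    rw [h4]
    exact sub_mem (sub_mem h1 (hsq (hpb s hidem) (hpb s (hlin j)))) h3
  -- The omitted index j₀ is recovered from the Taylor relation, where its coefficient is a nonzero
  -- constant.
  have hall : ∀ (s : G) (j : Fin 4), pullback s (shifted x j * ε ^ 2) ∈ J ⊔ I * I := by
    intro s j
    by_cases hj : j = j₀
    swap
    · exact hcoord s j hj
    subst hj
    set c : Fin 4 → coordinateRing := fun k =>
      algebraMap ℂ coordinateRing (dp x.1 (Pi.single k 1)) with hc
    have h1 := congrArg (fun f => pullback s (f * ε ^ 2)) (sum_dp_mul_shifted x)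
    have h2 : pullback s (c j) * pullback s (shifted x j * ε ^ 2)
        = (pullback s (shifted x 1 * ε) * pullback s (shifted x 2 * ε)
          - pullback s (shifted x 0 * ε) * pullback s (shifted x 3 * ε))
          - ∑ k ∈ Finset.univ.erase j,
            pullback s (c k) * pullback s (shifted x k * ε ^ 2) := by
      rw [eq_sub_iff_add_eq, Finset.add_sum_erase _
        (fun k => pullback s (c k) * pullback s (shifted x k * ε ^ 2)) (Finset.mem_univ j)]
      rw [Finset.sum_mul, map_sum] at h1
      convert! h1 using 1
      · refine Finset.sum_congr rfl fun k _ => ?_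
        simp only [map_mul, map_pow, hc]; ring
      · simp only [map_mul, map_pow, map_sub]; ring
    have h3 : pullback s (c j) * pullback s (shifted x j * ε ^ 2) ∈ J ⊔ I * I := by
      rw [h2]
      refine sub_mem (sub_mem (hsq (hpb s (hlin 1)) (hpb s (hlin 2)))
        (hsq (hpb s (hlin 0)) (hpb s (hlin 3)))) (sum_mem fun k hk => ?_)
      exact Ideal.mul_mem_left _ _ (hcoord s k (Finset.ne_of_mem_erase hk))
    have hunit : IsUnit (pullback s (c j)) :=
      ((isUnit_iff_ne_zero.2 hj₀).map (algebraMap ℂ coordinateRing)).map (pullback s)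
    exact (Ideal.unit_mul_mem_iff_mem _ hunit).1 h3
  intro f hf
  -- A partition of unity modulo I. The cube of ε replaces ε, at the cost of an error in I², because
  -- the local coordinates carry a factor ε².
  have hdecomp : f = f * (1 - ∑ s : G, pullback s ε)
      + ∑ s : G, (f * pullback s ε * (pullback s ε) ^ 2
        - f * pullback s ((ε ^ 2 - ε) * (1 + ε))) := by
    have : ∀ s : G, f * pullback s ε * (pullback s ε) ^ 2
        - f * pullback s ((ε ^ 2 - ε) * (1 + ε)) = f * pullback s ε := fun s => by
      simp only [map_mul, map_pow, map_sub, map_add, map_one]; ring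
    rw [Finset.sum_congr rfl fun s _ => this s, ← Finset.mul_sum]
    ring
  rw [hdecomp]
  refine add_mem (hsq hf hsum) (sum_mem fun s _ => sub_mem ?_ (hsq hf
    (hpb s (Ideal.mul_mem_right _ _ hidem))))
  obtain ⟨a, ha⟩ := exists_eq_sum_mul_shifted (x := x) (f := pullback (s⁻¹ : G) f)
    ((hIm f).1 hf _ (s⁻¹).2)
  have hf' : f = ∑ j, pullback s (a j) * pullback s (shifted x j) := by
    have := congrArg (pullback (s : Sym)) ha
    rw [← pullback_mul, Subgroup.coe_inv, inv_mul_cancel, pullback_one, map_sum] at this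
    simpa only [map_mul] using this
  have hterm : f * pullback s ε * (pullback s ε) ^ 2
      = ∑ j, (pullback s (a j) * pullback s ε) * pullback s (shifted x j * ε ^ 2) := by
    conv_lhs => rw [hf']
    rw [Finset.sum_mul, Finset.sum_mul]
    refine Finset.sum_congr rfl fun j _ => ?_
    simp only [map_mul, map_pow]; ring
  rw [hterm]
  exact sum_mem fun j _ => Ideal.mul_mem_left _ _ (hall s j)

/-- Nakayama gives r ≡ 1 modulo the ideal I of the orbit with r I generated by the invariants T
upstairs. The norm of r is an invariant multiple of r that is nonzero at x, and contraction through
the averaging operator brings the statement down to the invariant ring. -/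
lemma isSmoothAt_of_ne_origin [Finite G]
    (hfree : ∀ s ∈ G, s ≠ 1 → ∀ x : Cone, act s x = x → x = origin) {x : Cone}
    (hx : x ≠ origin) : IsSmoothAt G x := by
  have := Fintype.ofFinite G
  obtain ⟨ε, hε, hεx, hε0⟩ := exists_separating x (fun s : {s : G // s ≠ 1} => act s.1.1 x)
    fun s hs => hx (hfree _ s.1.2 (fun h => s.2 (Subtype.ext h)) x hs)
  obtain ⟨j₀, hj₀⟩ : ∃ j, dp x.1 (Pi.single j 1) ≠ 0 := by
    have hx' : x.1 ≠ 0 := fun h => hx (Subtype.ext h)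
    obtain ⟨n, hn⟩ := exists_dp_eq_one hx'
    by_contra! h
    have : dp x.1 = 0 := LinearMap.pi_ext' fun i => LinearMap.ext_ring (by simpa using h i)
    simp [this] at hn
  have hε0' : ∀ s ∈ G, s ≠ 1 → ε (act s x) = 0 := fun s hs h =>
    hε0 ⟨⟨s, hs⟩, fun h' => h (congrArg Subtype.val h')⟩
  have hle := vanishing_orbit_le G x ⟨ε, hε⟩ hεx hε0' j₀ hj₀
  set I := vanishing (orbit G x) with hI
  set T : {j // j ≠ j₀} → quotientRing G := fun j => localCoord G x ⟨ε, hε⟩ j with hT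
  obtain ⟨r, hr, hrJ⟩ := Submodule.exists_sub_one_mem_and_smul_le_of_fg_of_le_sup
    (I := I) (IsNoetherian.noetherian I) le_rfl hle
  refine isRegularLocalRing_of_generators (A := quotientRing G) (maximalIdealAt G x) T (fun j => ?_) (fun h hh => ?_) ?_
  · change (∑ s : G, pullback s (shifted x j * ⟨ε, hε⟩ ^ 2)).1 x = 0
    rw [sum_apply_coordinateRing]
    refine Finset.sum_eq_zero fun s _ => ?_
    rw [pow_two, ← mul_assoc]
    have hm : shifted x j * ⟨ε, hε⟩ * ⟨ε, hε⟩ ∈ vanishing (orbit G x) :=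
      Ideal.mul_mem_right _ _ (shifted_mul_mem_vanishing_orbit G (ε := ⟨ε, hε⟩) hε0' j)
    exact (mem_vanishing_orbit G).1 hm s s.2
  · refine ⟨normFun G r, fun hv => ?_, ?_⟩
    · have hv' : (∏ s : G, pullback s r).1 x = 0 := hv
      rw [prod_apply_coordinateRing, Finset.prod_eq_zero_iff] at hv'
      obtain ⟨s, _, hs⟩ := hv'
      have h1 : r.1 (act s x) - 1 = 0 := (mem_vanishing_orbit G).1 hr s s.2
      rw [pullback_apply] at hs
      rw [hs] at h1
      norm_num at h1
    · rw [← comap_map_incl G (Ideal.span (Set.range T))]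
      change incl G (normFun G r * h)
        ∈ Ideal.map (incl G).toRingHom (Ideal.span (Set.range T))
      have hmem : incl G h ∈ I := (mem_vanishing_orbit G).2 fun s hs => by
        change h.1 (act s x) = 0
        rw [h.2.2 s hs]
        exact hh
      have hrh : r * incl G h ∈ Ideal.map (incl G).toRingHom (Ideal.span (Set.range T)) :=
        hrJ (Submodule.smul_mem_pointwise_smul _ r I hmem)
      classical
      rw [map_mul, incl_normFun, ← Finset.prod_erase_mul _ _ (Finset.mem_univ (1 : G)), mul_assoc]
      refine Ideal.mul_mem_left _ _ ?_
      rwa [Subgroup.coe_one, pullback_one]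
  · have hcard : Fintype.card {j // j ≠ j₀} = 3 := by
      rw [Fintype.card_subtype_compl]
      simp
    rw [hcard]
    exact three_le_height G x hx

end Conifold

namespace Conifold

open MvPolynomial

/-! ## The singularity at the origin -/

/-- Derivations at a point bound the number of generators of its maximal ideal from below. -/
lemma finrank_le_spanFinrank_maximalIdeal {A W : Type*} [CommRing A] [IsNoetherianRing A]
    [AddCommGroup W] [Module ℂ W] (m : Ideal A) [m.IsPrime] (e : A →+* ℂ)
    (he : ∀ a, a ∈ m ↔ e a = 0) (D : A →+ W)
    (hD : ∀ a b, D (a * b) = e a • D b + e b • D a)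
    (hspan : Submodule.span ℂ (D '' m) = ⊤) :
    Module.finrank ℂ W ≤
      (IsLocalRing.maximalIdeal (Localization.AtPrime m)).spanFinrank := by
  have : IsNoetherianRing (Localization.AtPrime m) :=
    IsLocalization.isNoetherianRing m.primeCompl _ inferInstance
  set M := IsLocalRing.maximalIdeal (Localization.AtPrime m) with hM
  have hfg : Submodule.FG M := IsNoetherian.noetherian M
  have hS : ∀ s : M.generators, ∃ t ∈ m,
      ∃ u : Localization.AtPrime m, (s : Localization.AtPrime m) = u * algebraMap A _ t := by
    intro s
    have hsM : (s : Localization.AtPrime m) ∈ M := Submodule.FG.generators_mem M s.2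
    obtain ⟨⟨t, d⟩, htd⟩ := IsLocalization.surj m.primeCompl (s : Localization.AtPrime m)
    have hd : IsUnit (algebraMap A (Localization.AtPrime m) d) := IsLocalization.map_units _ d
    refine ⟨t, ?_, ↑hd.unit⁻¹, ?_⟩
    · rw [← IsLocalization.AtPrime.to_map_mem_maximal_iff (Localization.AtPrime m) m, ← htd]
      exact Ideal.mul_mem_right _ _ hsM
    · rw [← htd, mul_comm (s : Localization.AtPrime m), ← mul_assoc, IsUnit.val_inv_mul, one_mul]
  choose T hTm U hU using hS
  have hle : M ≤ (Ideal.span (Set.range T)).map (algebraMap A (Localization.AtPrime m)) := by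
    refine (Submodule.span_generators M).ge.trans ?_
    rw [Ideal.submodule_span_eq, Ideal.span_le]
    intro s hs
    rw [show s = _ from hU ⟨s, hs⟩]
    exact Ideal.mul_mem_left _ _ (Ideal.mem_map_of_mem _ (Ideal.subset_span ⟨_, rfl⟩))
  have hTspan : Ideal.span (Set.range T) ≤ m := by
    rw [Ideal.span_le]
    rintro _ ⟨s, rfl⟩
    exact hTm s
  have hDT : ∀ a ∈ Ideal.span (Set.range T),
      D a ∈ Submodule.span ℂ (Set.range fun s => D (T s)) := by
    intro a ha
    refine Submodule.span_induction ?_ ?_ ?_ ?_ ha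
    · rintro _ ⟨s, rfl⟩
      exact Submodule.subset_span ⟨s, rfl⟩
    · rw [map_zero]
      exact zero_mem _
    · intro a b _ _ ha hb
      rw [map_add]
      exact add_mem ha hb
    · intro c a ha hDa
      rw [smul_eq_mul, hD, (he a).1 (hTspan ha), zero_smul, add_zero]
      exact Submodule.smul_mem _ _ hDa
  have htop : Submodule.span ℂ (Set.range fun s => D (T s)) = ⊤ := by
    rw [eq_top_iff, ← hspan, Submodule.span_le]
    rintro _ ⟨a, ha, rfl⟩
    have haM : algebraMap A (Localization.AtPrime m) a ∈ M :=
      (IsLocalization.AtPrime.to_map_mem_maximal_iff (Localization.AtPrime m) m a).2 ha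
    obtain ⟨v, hv, hva⟩ := (IsLocalization.algebraMap_mem_map_algebraMap_iff m.primeCompl
      (Localization.AtPrime m) _ a).1 (hle haM)
    have h1 := hDT _ hva
    rw [hD, (he a).1 ha, zero_smul, add_zero] at h1
    have hv0 : e v ≠ 0 := fun h => hv ((he v).2 h)
    exact (Submodule.smul_mem_iff _ hv0).1 h1
  have hfin := hfg.finite_generators
  have := hfin.fintype
  calc Module.finrank ℂ W = Module.finrank ℂ (⊤ : Submodule ℂ W) := (finrank_top ℂ W).symm
    _ = Set.finrank ℂ (Set.range fun s => D (T s)) := by rw [← htop]; rfl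
    _ ≤ Fintype.card M.generators := finrank_range_le_card _
    _ = M.generators.ncard := by rw [← Nat.card_eq_fintype_card]; rfl
    _ = M.spanFinrank := hfg.generators_ncard

/-- The multiple of a point of the conifold. -/
def scale (t : ℂ) (v : Cone) : Cone := ⟨t • v.1, by
  have hv : v.1 0 * v.1 3 - v.1 1 * v.1 2 = 0 := v.2
  simp only [p, Pi.smul_apply, smul_eq_mul]
  linear_combination t ^ 2 * hv⟩

lemma exists_linePoly (v : Cone) (f : coordinateRing) :
    ∃ P : Polynomial ℂ, ∀ t, f.1 (scale t v) = P.eval t := by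
  obtain ⟨F, hF⟩ := mem_coordinateRing_iff.1 f.2
  refine ⟨aeval (fun i => Polynomial.C (v.1 i) * Polynomial.X) F, fun t => ?_⟩
  rw [hF, ← Polynomial.coe_evalRingHom, ← MvPolynomial.coe_aeval_eq_eval]
  have h : (Polynomial.evalRingHom t).comp (aeval (fun i =>
      Polynomial.C (v.1 i) * Polynomial.X)).toRingHom
        = (aeval (R := ℂ) (scale t v).1 : MvPolynomial (Fin 4) ℂ →ₐ[ℂ] ℂ).toRingHom := by
    refine MvPolynomial.ringHom_ext (fun c => ?_) fun i => ?_
    · change Polynomial.eval t (aeval _ (C c)) = aeval (scale t v).1 (C c)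
      rw [algHom_C, algHom_C]
      exact Polynomial.eval_C
    · change Polynomial.eval t (aeval _ (X i)) = aeval (scale t v).1 (X i)
      rw [aeval_X, aeval_X]
      rw [Polynomial.eval_mul, Polynomial.eval_C, Polynomial.eval_X, mul_comm]
      rfl
  exact (DFunLike.congr_fun h F).symm

/-- The restriction of a regular function to the line through a point. -/
def linePoly (v : Cone) (f : coordinateRing) : Polynomial ℂ := (exists_linePoly v f).choose

lemma eval_linePoly (v : Cone) (f : coordinateRing) (t : ℂ) :
    (linePoly v f).eval t = f.1 (scale t v) := ((exists_linePoly v f).choose_spec t).symm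

lemma linePoly_eq {v : Cone} {f : coordinateRing} {P : Polynomial ℂ}
    (h : ∀ t, f.1 (scale t v) = P.eval t) : linePoly v f = P :=
  Polynomial.funext fun t => by rw [eval_linePoly, h]

lemma linePoly_add (v : Cone) (f g : coordinateRing) :
    linePoly v (f + g) = linePoly v f + linePoly v g :=
  linePoly_eq fun t => by rw [Polynomial.eval_add, eval_linePoly, eval_linePoly]; rfl

lemma linePoly_mul (v : Cone) (f g : coordinateRing) :
    linePoly v (f * g) = linePoly v f * linePoly v g :=
  linePoly_eq fun t => by rw [Polynomial.eval_mul, eval_linePoly, eval_linePoly]; rfl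

lemma coeff_zero_linePoly (v : Cone) (f : coordinateRing) :
    (linePoly v f).coeff 0 = f.1 origin := by
  have h : scale 0 v = origin := Subtype.ext (zero_smul ℂ v.1)
  rw [Polynomial.coeff_zero_eq_eval_zero, eval_linePoly, h]

/-- Invariance under t ↦ c t multiplies the n-th coefficient by cⁿ without changing it. -/
lemma coeff_linePoly_eq_zero {v : Cone} {f : coordinateRing} {c : ℂ}
    (h : ∀ t, f.1 (scale (c * t) v) = f.1 (scale t v)) {n : ℕ} (hn : c ^ n ≠ 1) :
    (linePoly v f).coeff n = 0 := by
  have h1 : (linePoly v f).comp (Polynomial.C c * Polynomial.X) = linePoly v f :=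
    Polynomial.funext fun t => by
      rw [Polynomial.eval_comp, eval_linePoly, eval_linePoly]
      simpa using h t
  have h2 := congrArg (Polynomial.coeff · n) h1
  rw [Polynomial.comp_C_mul_X_coeff] at h2
  by_contra h0
  exact hn (mul_left_cancel₀ h0 (by rw [h2, mul_one]))

/-- The leading coefficients of invariant functions along four lines. -/
def jet (f : coordinateRing) : Fin 4 → ℂ :=
  ![(linePoly ⟨![0, 1, 0, 0], by simp [p]⟩ f).coeff 2,
    (linePoly ⟨![1, 1, 0, 0], by simp [p]⟩ f).coeff 2,
    (linePoly ⟨![0, 1, 0, 1], by simp [p]⟩ f).coeff 2,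
    (linePoly ⟨![1, 0, 0, 0], by simp [p]⟩ f).coeff 4]

lemma jet_add (a b : coordinateRing) : jet (a + b) = jet a + jet b := by
  ext i
  fin_cases i <;> simp [jet, linePoly_add]

/-- The symmetry of order four acts in the required way. -/
def ActsAsGenerator (g : Sym) : Prop :=
  ∀ y : V, rep g y = ![Complex.I * y 0, y 2, -y 1, Complex.I * y 3]

variable {g : Sym}

lemma ActsAsGenerator.act_sq (hg : ActsAsGenerator g) (x : Cone) :
    act g (act g x) = scale (-1) x := by
  refine Subtype.ext ?_
  change rep g (rep g x.1) = (-1 : ℂ) • x.1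
  rw [hg, hg]
  ext i
  fin_cases i <;> simp [← mul_assoc]

lemma mem_quotientRing_zpowers {f : Cone → ℂ} (hf : f ∈ coordinateRing)
    (h : ∀ x, f (act g x) = f x) : f ∈ quotientRing (Subgroup.zpowers g) := by
  let S : Subgroup Sym :=
    { carrier := {s | ∀ x, f (act s x) = f x}
      one_mem' := fun x => by rw [act_one]
      mul_mem' := fun {s t} hs ht x => by rw [act_mul, hs, ht]
      inv_mem' := fun {s} hs x => by rw [← hs, act_act_inv] }
  exact ⟨hf, fun s hs => (Subgroup.zpowers_le (H := S)).2 h hs⟩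

lemma ActsAsGenerator.apply_neg (hg : ActsAsGenerator g)
    (f : quotientRing (Subgroup.zpowers g)) (x : Cone) (t : ℂ) :
    f.1 (scale (-1 * t) x) = f.1 (scale t x) := by
  have h : scale (-1 * t) x = act g (act g (scale t x)) := by
    rw [hg.act_sq]
    exact Subtype.ext (by simp [scale])
  rw [h, f.2.2 g (Subgroup.mem_zpowers g), f.2.2 g (Subgroup.mem_zpowers g)]

lemma ActsAsGenerator.apply_I (hg : ActsAsGenerator g)
    (f : quotientRing (Subgroup.zpowers g)) (t : ℂ) :
    f.1 (scale (Complex.I * t) ⟨![1, 0, 0, 0], by simp [p]⟩)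
      = f.1 (scale t ⟨![1, 0, 0, 0], by simp [p]⟩) := by
  have h : scale (Complex.I * t) ⟨![1, 0, 0, 0], by simp [p]⟩
      = act g (scale t ⟨![1, 0, 0, 0], by simp [p]⟩) := by
    refine Subtype.ext ?_
    change _ = rep g _
    rw [hg]
    ext i
    fin_cases i <;> simp [scale]
  rw [h, f.2.2 g (Subgroup.mem_zpowers g)]

/-- The jet is a derivation at the origin because the intermediate coefficients vanish on
invariants: the linear one on every line, as g² = -1, and those of degrees 1, 2, 3 on the first
axis, where g acts as i. -/
lemma ActsAsGenerator.jet_mul (hg : ActsAsGenerator g)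
    (a b : quotientRing (Subgroup.zpowers g)) :
    jet (incl _ (a * b)) = a.1 origin • jet (incl _ b) + b.1 origin • jet (incl _ a) := by
  have h2 : ∀ v : Cone, (linePoly v (incl _ (a * b))).coeff 2
      = a.1 origin * (linePoly v (incl _ b)).coeff 2
        + b.1 origin * (linePoly v (incl _ a)).coeff 2 := fun v => by
    have h1 : ∀ f : quotientRing (Subgroup.zpowers g), (linePoly v (incl _ f)).coeff 1 = 0 :=
      fun f => coeff_linePoly_eq_zero (f := incl _ f) (c := -1)
        (fun t => hg.apply_neg f v t) (by norm_num)
    rw [map_mul, linePoly_mul, Polynomial.coeff_mul,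
      Finset.Nat.sum_antidiagonal_eq_sum_range_succ_mk]
    simp only [Finset.sum_range_succ, Finset.sum_range_zero, h1, coeff_zero_linePoly,
      Nat.sub_self, Nat.sub_zero]
    change 0 + a.1 origin * _ + 0 * _ + _ * b.1 origin = _
    ring
  have h4 : ∀ v : Cone, v = ⟨![1, 0, 0, 0], by simp [p]⟩ →
      (linePoly v (incl _ (a * b))).coeff 4
      = a.1 origin * (linePoly v (incl _ b)).coeff 4
        + b.1 origin * (linePoly v (incl _ a)).coeff 4 := fun v hv => by
    have h1 : ∀ n, Complex.I ^ n ≠ 1 → ∀ f : quotientRing (Subgroup.zpowers g),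
        (linePoly v (incl _ f)).coeff n = 0 := fun n hn f =>
      coeff_linePoly_eq_zero (f := incl _ f) (c := Complex.I)
        (fun t => by rw [hv]; exact hg.apply_I f t) hn
    have i1 : Complex.I ≠ 1 := fun h => by simpa using congrArg Complex.im h
    have e1 := h1 1 (by rwa [pow_one])
    have e2 := h1 2 (by rw [Complex.I_sq]; norm_num)
    have e3 := h1 3 (by
      rw [Complex.I_pow_three]
      exact fun h => by simpa using congrArg Complex.im h)
    rw [map_mul, linePoly_mul, Polynomial.coeff_mul,
      Finset.Nat.sum_antidiagonal_eq_sum_range_succ_mk]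
    simp only [Finset.sum_range_succ, Finset.sum_range_zero, e1, e2, e3, coeff_zero_linePoly,
      Nat.sub_self, Nat.sub_zero]
    change 0 + a.1 origin * _ + 0 * _ + 0 * _ + 0 * _ + _ * b.1 origin = _
    ring
  ext i
  fin_cases i
  · exact h2 _
  · exact h2 _
  · exact h2 _
  · exact h4 _ rfl

lemma coeff_linePoly_of_eq {v : Cone} {f : coordinateRing} {c : ℂ} {n : ℕ}
    (h : ∀ t, f.1 (scale t v) = c * t ^ n) (k : ℕ) :
    (linePoly v f).coeff k = if k = n then c else 0 := by
  rw [linePoly_eq (P := Polynomial.C c * Polynomial.X ^ n) (fun t => by rw [h]; simp),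
    Polynomial.coeff_C_mul_X_pow]

lemma ActsAsGenerator.act_apply (hg : ActsAsGenerator g) (x : Cone) :
    (act g x).1 = ![Complex.I * x.1 0, x.1 2, -x.1 1, Complex.I * x.1 3] := hg x.1

lemma ActsAsGenerator.span_jet (hg : ActsAsGenerator g) :
    Submodule.span ℂ ((fun f => jet (incl (Subgroup.zpowers g) f)) ''
      (maximalIdealAt (Subgroup.zpowers g) origin)) = ⊤ := by
  set S := Submodule.span ℂ ((fun f => jet (incl (Subgroup.zpowers g) f)) ''
      (maximalIdealAt (Subgroup.zpowers g) origin)) with hS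
  have hmem : ∀ (f : Cone → ℂ) (hf : f ∈ coordinateRing), (∀ x, f (act g x) = f x) →
      f origin = 0 → jet ⟨f, hf⟩ ∈ S := fun f hf h h0 =>
    Submodule.subset_span ⟨⟨f, mem_quotientRing_zpowers hf h⟩, h0, rfl⟩
  have hw : ∀ c : ℂ, (fun x : Cone => x.1 1 + c * x.1 2) ∈ coordinateRing := fun c =>
    add_mem (coord_mem 1) (mul_mem (const_mem c) (coord_mem 2))
  have hjet : ∀ (f : Cone → ℂ) (hf : f ∈ coordinateRing) (c : Fin 4 → ℂ) (n : Fin 4 → ℕ),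
      (∀ t, f (scale t ⟨![0, 1, 0, 0], by simp [p]⟩) = c 0 * t ^ n 0) →
      (∀ t, f (scale t ⟨![1, 1, 0, 0], by simp [p]⟩) = c 1 * t ^ n 1) →
      (∀ t, f (scale t ⟨![0, 1, 0, 1], by simp [p]⟩) = c 2 * t ^ n 2) →
      (∀ t, f (scale t ⟨![1, 0, 0, 0], by simp [p]⟩) = c 3 * t ^ n 3) →
      jet ⟨f, hf⟩ = ![if 2 = n 0 then c 0 else 0, if 2 = n 1 then c 1 else 0,
        if 2 = n 2 then c 2 else 0, if 4 = n 3 then c 3 else 0] := by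
    intro f hf c n h0 h1 h2 h3
    simp only [jet, coeff_linePoly_of_eq (f := ⟨f, hf⟩) h0, coeff_linePoly_of_eq (f := ⟨f, hf⟩) h1,
      coeff_linePoly_of_eq (f := ⟨f, hf⟩) h2, coeff_linePoly_of_eq (f := ⟨f, hf⟩) h3]
  have I2 := Complex.I_sq
  have I4 := Complex.I_pow_four
  -- The linear form y₂ + i y₃ is an eigenvector of g with eigenvalue -i, which cancels the factor i
  -- of y₁ and of y₄. The invariants used are y₁(y₂ + i y₃), y₄(y₂ + i y₃), y₂² + y₃² and y₁⁴.
  have r1 : (![0, 1, 0, 0] : Fin 4 → ℂ) ∈ S := by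
    have hf := mul_mem (coord_mem 0) (hw Complex.I)
    have := hmem _ hf (fun x => by
      simp only [Pi.mul_apply, hg.act_apply]
      simp
      linear_combination (-x.1 0 * x.1 1) * I2) (by simp [origin])
    rw [hjet _ hf ![0, 1, 0, 0] ![2, 2, 2, 2]
      (by intro t; simp [scale]) (by intro t; simp [scale]; ring)
      (by intro t; simp [scale]) (by intro t; simp [scale])] at this
    simpa using this
  have r2 : (![0, 0, 1, 0] : Fin 4 → ℂ) ∈ S := by
    have hf := mul_mem (coord_mem 3) (hw Complex.I)
    have := hmem _ hf (fun x => by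
      simp only [Pi.mul_apply, hg.act_apply]
      simp
      linear_combination (-x.1 3 * x.1 1) * I2) (by simp [origin])
    rw [hjet _ hf ![0, 0, 1, 0] ![2, 2, 2, 2]
      (by intro t; simp [scale]) (by intro t; simp [scale])
      (by intro t; simp [scale]; ring) (by intro t; simp [scale])] at this
    simpa using this
  have r3 : (![1, 1, 1, 0] : Fin 4 → ℂ) ∈ S := by
    have hf := mul_mem (hw (-Complex.I)) (hw Complex.I)
    have := hmem _ hf (fun x => by
      simp only [Pi.mul_apply, hg.act_apply]
      simp
      linear_combination (x.1 2 ^ 2 - x.1 1 ^ 2) * I2) (by simp [origin])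
    rw [hjet _ hf ![1, 1, 1, 0] ![2, 2, 2, 2]
      (by intro t; simp [scale]; ring) (by intro t; simp [scale]; ring)
      (by intro t; simp [scale]; ring) (by intro t; simp [scale])] at this
    simpa using this
  have r4 : (![0, 0, 0, 1] : Fin 4 → ℂ) ∈ S := by
    have hf := pow_mem (coord_mem 0) 4
    have := hmem _ hf (fun x => by
      simp only [Pi.pow_apply, hg.act_apply]
      simp
      linear_combination (x.1 0 ^ 4) * I4) (by simp [origin])
    rw [hjet _ hf ![0, 1, 0, 1] ![4, 4, 4, 4]
      (by intro t; simp [scale]) (by intro t; simp [scale])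
      (by intro t; simp [scale]) (by intro t; simp [scale])] at this
    simpa using this
  rw [eq_top_iff]
  intro w _
  have hw : w = w 0 • ![1, 1, 1, 0] + (w 1 - w 0) • ![0, 1, 0, 0] + (w 2 - w 0) • ![0, 0, 1, 0]
      + w 3 • ![0, 0, 0, 1] := by
    ext i
    fin_cases i <;> simp
  rw [hw]
  exact add_mem (add_mem (add_mem (S.smul_mem _ r3) (S.smul_mem _ r1)) (S.smul_mem _ r2))
    (S.smul_mem _ r4)

/-- Krull's height theorem for the invariants y₁⁴, y₄⁴, y₂⁴ + y₃⁴. A prime of the coordinate ring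
containing them contains y₁ and y₄, hence y₂ y₃ = y₁ y₄, hence all coordinates; lying over transfers
this to the invariant ring. -/
lemma ActsAsGenerator.height_le (hg : ActsAsGenerator g) [Finite (Subgroup.zpowers g)] :
    (maximalIdealAt (Subgroup.zpowers g) origin).height ≤ 3 := by
  set H := Subgroup.zpowers g
  have I4 := Complex.I_pow_four
  let f₁ : quotientRing H := ⟨_, mem_quotientRing_zpowers (g := g) (pow_mem (coord_mem 0) 4)
    fun x => by
      simp only [Pi.pow_apply, hg.act_apply]
      simp
      linear_combination (x.1 0 ^ 4) * I4⟩
  let f₂ : quotientRing H := ⟨_, mem_quotientRing_zpowers (g := g) (pow_mem (coord_mem 3) 4)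
    fun x => by
      simp only [Pi.pow_apply, hg.act_apply]
      simp
      linear_combination (x.1 3 ^ 4) * I4⟩
  let f₃ : quotientRing H := ⟨_, mem_quotientRing_zpowers (g := g)
    (add_mem (pow_mem (coord_mem 1) 4) (pow_mem (coord_mem 2) 4)) fun x => by
      simp only [Pi.pow_apply, Pi.add_apply, hg.act_apply]
      simp
      ring⟩
  have hfin : ({f₁, f₂, f₃} : Set (quotientRing H)).Finite := Set.toFinite _
  have hcard : ({f₁, f₂, f₃} : Set (quotientRing H)).ncard ≤ 3 := by
    refine (Set.ncard_insert_le _ _).trans ?_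
    have := Set.ncard_insert_le f₂ ({f₃} : Set (quotientRing H))
    rw [Set.ncard_singleton] at this
    omega
  refine (Ideal.height_le_card_of_mem_minimalPrimes_span hfin
    ⟨⟨inferInstance, ?_⟩, ?_⟩).trans (by exact_mod_cast hcard)
  · rw [Ideal.span_le]
    rintro f (rfl | rfl | rfl)
    · change (0 : ℂ) ^ 4 = 0
      norm_num
    · change (0 : ℂ) ^ 4 = 0
      norm_num
    · change (0 : ℂ) ^ 4 + 0 ^ 4 = 0
      norm_num
  · rintro Q ⟨hQ, hle⟩ -
    obtain ⟨Q', -, hQ', hcomap⟩ := Ideal.exists_ideal_over_prime_of_isIntegral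
      (S := coordinateRing) Q ⊥ (fun f hf => by
        have : f = 0 := incl_injective H (hf.trans (map_zero _).symm)
        rw [this]
        exact zero_mem _)
    have hmem : ∀ f ∈ ({f₁, f₂, f₃} : Set (quotientRing H)), incl H f ∈ Q' := fun f hf => by
      have : f ∈ Q'.comap (algebraMap (quotientRing H) coordinateRing) :=
        hcomap ▸ hle (Ideal.subset_span hf)
      exact this
    have h0 : coord 0 ∈ Q' := hQ'.mem_of_pow_mem 4 (hmem f₁ (by simp))
    have h3 : coord 3 ∈ Q' := hQ'.mem_of_pow_mem 4 (hmem f₂ (by simp))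
    have hsum : coord 1 ^ 4 + coord 2 ^ 4 ∈ Q' := hmem f₃ (by simp)
    have h12 : coord 1 * coord 2 ∈ Q' := by
      have : coord 1 * coord 2 = coord 0 * coord 3 :=
        Subtype.ext (funext fun x => (sub_eq_zero.1 x.2).symm)
      rw [this]
      exact Q'.mul_mem_left _ h3
    have h12' : coord 1 ∈ Q' ∧ coord 2 ∈ Q' := by
      rcases hQ'.mem_or_mem h12 with h | h
      · have := (Q'.add_mem_iff_right (Ideal.pow_mem_of_mem _ h 4 (by norm_num))).1 hsum
        exact ⟨h, hQ'.mem_of_pow_mem 4 this⟩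
      · have := (Q'.add_mem_iff_left (Ideal.pow_mem_of_mem _ h 4 (by norm_num))).1 hsum
        exact ⟨hQ'.mem_of_pow_mem 4 this, h⟩
    have hall : ∀ j, coord j ∈ Q' := by
      intro j
      fin_cases j
      · exact h0
      · exact h12'.1
      · exact h12'.2
      · exact h3
    intro f hf
    rw [← hcomap]
    change incl H f ∈ Q'
    obtain ⟨a, ha⟩ := exists_eq_sum_mul_shifted (x := origin) (f := incl H f) hf
    rw [ha]
    refine sum_mem fun j _ => Q'.mul_mem_left _ ?_
    have : shifted origin j = coord j := Subtype.ext (funext fun x => by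
      simp [shifted_apply, coord_apply, origin])
    rw [this]
    exact hall j

lemma ActsAsGenerator.not_isSmoothAt_origin (hg : ActsAsGenerator g)
    [Finite (Subgroup.zpowers g)] : ¬ IsSmoothAt (Subgroup.zpowers g) origin := by
  intro h
  set m := maximalIdealAt (Subgroup.zpowers g) origin
  have h1 := h.spanFinrank_maximalIdeal
  rw [IsLocalization.AtPrime.ringKrullDim_eq_height m] at h1
  have h2 := hg.height_le
  have h3 := finrank_le_spanFinrank_maximalIdeal m (evalAt _ origin).toRingHom (fun _ => Iff.rfl)
    (AddMonoidHom.mk' (fun f => jet (incl (Subgroup.zpowers g) f)) fun a b => by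
      rw [map_add, jet_add]) hg.jet_mul hg.span_jet
  rw [Module.finrank_fin_fun] at h3
  have h4 : ((IsLocalRing.maximalIdeal (Localization.AtPrime m)).spanFinrank : ℕ∞) ≤ 3 := by
    have h5 : ((IsLocalRing.maximalIdeal (Localization.AtPrime m)).spanFinrank : ℕ∞)
      = m.height := by exact_mod_cast h1
    rw [h5]
    exact h2
  have h5 : (IsLocalRing.maximalIdeal (Localization.AtPrime m)).spanFinrank ≤ 3 := by
    exact_mod_cast h4
  omega

end Conifold

namespace Conifold

/-! ## Elements of the symmetry group -/

/-- Scalar matrices. -/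
abbrev sc (l : ℂˣ) : GL (Fin 2) ℂ := Matrix.GeneralLinearGroup.scalar (Fin 2) l

lemma sc_coe (l : ℂˣ) : ((sc l : GL (Fin 2) ℂ) : Matrix (Fin 2) (Fin 2) ℂ) = (l : ℂ) • 1 := by
  rw [Matrix.smul_one_eq_diagonal]
  rfl

lemma sc_comm (l : ℂˣ) (A : GL (Fin 2) ℂ) : sc l * A = A * sc l :=
  Matrix.GeneralLinearGroup.scalar_commute l A

lemma sc_injective : Function.Injective sc := fun l m h => by
  have h1 := congrArg (fun A : GL (Fin 2) ℂ => A.1 0 0) h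
  simp only [sc_coe] at h1
  exact Units.ext (by simpa using h1)

/-- The symmetry `Y ↦ A Y Bᵀ`. -/
def inner (A B : GL (Fin 2) ℂ) : Sym := ⟨QuotientGroup.mk (A, B), 1⟩

/-- The symmetry `Y ↦ A Yᵀ Bᵀ`. -/
def outer (A B : GL (Fin 2) ℂ) : Sym := ⟨QuotientGroup.mk (A, B), Multiplicative.ofAdd 1⟩

lemma eq_inner_or_eq_outer (s : Sym) :
    (∃ A B, s = inner A B) ∨ ∃ A B, s = outer A B := by
  obtain ⟨x, e⟩ := s
  have h : ∀ c : Multiplicative (ZMod 2), c = 1 ∨ c = Multiplicative.ofAdd 1 := by decide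
  induction x using QuotientGroup.induction_on with
  | H a =>
    rcases h e with rfl | rfl
    · exact Or.inl ⟨a.1, a.2, rfl⟩
    · exact Or.inr ⟨a.1, a.2, rfl⟩

lemma toZTwo_inner (A B : GL (Fin 2) ℂ) : toZTwo (inner A B) = 1 := rfl

lemma toZTwo_outer (A B : GL (Fin 2) ℂ) : toZTwo (outer A B) ≠ 1 := by
  change Multiplicative.ofAdd (1 : ZMod 2) ≠ 1
  decide

lemma inner_mul_inner (A B P Q : GL (Fin 2) ℂ) :
    inner A B * inner P Q = inner (A * P) (B * Q) := by
  refine SemidirectProduct.ext ?_ rfl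
  simp only [inner, SemidirectProduct.mul_left, map_one, MulAut.one_apply]
  rfl

lemma inner_mul_outer (A B P Q : GL (Fin 2) ℂ) :
    inner A B * outer P Q = outer (A * P) (B * Q) := by
  refine SemidirectProduct.ext ?_ rfl
  simp only [inner, outer, SemidirectProduct.mul_left, map_one, MulAut.one_apply]
  rfl

lemma zTwoHom_generator :
    zTwoHom swapAut swapAut_mul_self (Multiplicative.ofAdd (1 : ZMod 2)) = swapAut := by
  have h1 : (Multiplicative.ofAdd (1 : ZMod 2)) ≠ 1 := by decide
  simp [zTwoHom, h1]

lemma outer_mul_inner (A B P Q : GL (Fin 2) ℂ) :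
    outer A B * inner P Q = outer (A * Q) (B * P) := by
  refine SemidirectProduct.ext ?_ rfl
  simp only [inner, outer, SemidirectProduct.mul_left, zTwoHom_generator]
  rfl

lemma outer_mul_outer (A B P Q : GL (Fin 2) ℂ) :
    outer A B * outer P Q = inner (A * Q) (B * P) := by
  refine SemidirectProduct.ext ?_
    (show Multiplicative.ofAdd (1 : ZMod 2) * Multiplicative.ofAdd 1 = 1 by decide)
  simp only [inner, outer, SemidirectProduct.mul_left, zTwoHom_generator]
  rfl

lemma mk_eq_mk_iff (A B P Q : GL (Fin 2) ℂ) :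
    (QuotientGroup.mk (A, B) : Connected) = QuotientGroup.mk (P, Q)
      ↔ ∃ l : ℂˣ, P = sc l * A ∧ Q = sc l⁻¹ * B := by
  rw [QuotientGroup.eq]
  refine exists_congr fun l => ?_
  rw [Prod.ext_iff]
  change sc l = A⁻¹ * P ∧ sc l⁻¹ = B⁻¹ * Q ↔ _
  rw [eq_inv_mul_iff_mul_eq, eq_inv_mul_iff_mul_eq, ← sc_comm, ← sc_comm, eq_comm,
    eq_comm (b := Q)]

lemma inner_eq_inner_iff (A B P Q : GL (Fin 2) ℂ) :
    inner A B = inner P Q ↔ ∃ l : ℂˣ, P = sc l * A ∧ Q = sc l⁻¹ * B := by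
  rw [← mk_eq_mk_iff, SemidirectProduct.ext_iff]
  exact and_iff_left rfl

lemma outer_eq_outer_iff (A B P Q : GL (Fin 2) ℂ) :
    outer A B = outer P Q ↔ ∃ l : ℂˣ, P = sc l * A ∧ Q = sc l⁻¹ * B := by
  rw [← mk_eq_mk_iff, SemidirectProduct.ext_iff]
  exact and_iff_left rfl

lemma inner_one : inner 1 1 = 1 := rfl

lemma inner_eq_one_iff (P Q : GL (Fin 2) ℂ) :
    inner P Q = 1 ↔ ∃ l : ℂˣ, P = sc l ∧ Q = sc l⁻¹ := by
  rw [← inner_one, eq_comm, inner_eq_inner_iff]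
  simp only [mul_one]

lemma rep_inner (A B : GL (Fin 2) ℂ) (y : V) :
    rep (inner A B) y = toMatrix.symm (A.1 * toMatrix y * B.1.transpose) := by
  change (connectedHom _ * zTwoHom _ _ 1) y = _
  rw [map_one, mul_one]
  rfl

lemma rep_outer (A B : GL (Fin 2) ℂ) (y : V) :
    rep (outer A B) y = toMatrix.symm (A.1 * (toMatrix y).transpose * B.1.transpose) := by
  change (connectedHom (QuotientGroup.mk (A, B)) * zTwoHom transposeEquiv transposeEquiv_mul_self
    (Multiplicative.ofAdd 1)) y = _
  have h1 : (Multiplicative.ofAdd (1 : ZMod 2)) ≠ 1 := by decide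
  rw [LinearEquiv.mul_apply]
  simp only [zTwoHom, MonoidHom.coe_mk, OneHom.coe_mk, h1, if_false]
  change glHom (A, B) (transposeEquiv y) = _
  rw [glHom_apply, transposeEquiv_apply, LinearEquiv.apply_symm_apply]

lemma rep_outer_eq (A B : GL (Fin 2) ℂ) (y : V) : rep (outer A B) y =
    ![(A.1 0 0 * y 0 + A.1 0 1 * y 1) * B.1 0 0 + (A.1 0 0 * y 2 + A.1 0 1 * y 3) * B.1 0 1,
      (A.1 0 0 * y 0 + A.1 0 1 * y 1) * B.1 1 0 + (A.1 0 0 * y 2 + A.1 0 1 * y 3) * B.1 1 1,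
      (A.1 1 0 * y 0 + A.1 1 1 * y 1) * B.1 0 0 + (A.1 1 0 * y 2 + A.1 1 1 * y 3) * B.1 0 1,
      (A.1 1 0 * y 0 + A.1 1 1 * y 1) * B.1 1 0 + (A.1 1 0 * y 2 + A.1 1 1 * y 3) * B.1 1 1] := by
  rw [rep_outer]
  ext i
  fin_cases i <;> simp [toMatrix, Matrix.mul_apply, Fin.sum_univ_two]

lemma multiplier_outer (A B : GL (Fin 2) ℂ) :
    multiplier (outer A B) = A.1.det * B.1.det := by
  refine multiplier_eq fun y => ?_
  rw [rep_outer_eq, Matrix.det_fin_two, Matrix.det_fin_two]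
  simp [p]
  ring

lemma det_rep_outer (A B : GL (Fin 2) ℂ) :
    LinearMap.det (rep (outer A B)).toLinearMap = -(A.1.det * B.1.det) ^ 2 := by
  have h := det4_rep (outer A B) (fun i => Pi.single i 1)
  have h1 : det4 (fun i => Pi.single i 1) = 1 := by
    have : det4 = (Pi.basisFun ℂ (Fin 4)).det := (Pi.basisFun_det).symm
    rw [this]
    convert! Module.Basis.det_self (Pi.basisFun ℂ (Fin 4)) using 2
    ext i
    simp
  rw [h1, mul_one] at h
  have hM : Matrix.of (fun i => rep (outer A B) (Pi.single i 1)) =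
      !![A.1 0 0 * B.1 0 0, A.1 0 0 * B.1 1 0, A.1 1 0 * B.1 0 0, A.1 1 0 * B.1 1 0;
        A.1 0 1 * B.1 0 0, A.1 0 1 * B.1 1 0, A.1 1 1 * B.1 0 0, A.1 1 1 * B.1 1 0;
        A.1 0 0 * B.1 0 1, A.1 0 0 * B.1 1 1, A.1 1 0 * B.1 0 1, A.1 1 0 * B.1 1 1;
        A.1 0 1 * B.1 0 1, A.1 0 1 * B.1 1 1, A.1 1 1 * B.1 0 1, A.1 1 1 * B.1 1 1] := by
    ext i j
    rw [Matrix.of_apply, rep_outer_eq]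
    fin_cases i <;> fin_cases j <;> simp
  rw [← h]
  change Matrix.det (Matrix.of fun i => rep (outer A B) (Pi.single i 1)) = _
  rw [hM, Matrix.det_fin_two, Matrix.det_fin_two, Matrix.det_succ_row_zero]
  simp [Fin.sum_univ_succ, Matrix.det_fin_three, Fin.succAbove]
  ring

/-- The sign is the determinant of the transposition y₂ ↔ y₃; it is what forces det(AB) = -1 later.
-/
lemma residueFactor_outer (A B : GL (Fin 2) ℂ) :
    residueFactor (outer A B) = -(A.1.det * B.1.det) := by
  have h : A.1.det * B.1.det ≠ 0 := by
    rw [← multiplier_outer]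
    exact multiplier_ne_zero _
  rw [residueFactor, det_rep_outer, multiplier_outer]
  field_simp

/-! ## Fixed points -/

lemma exists_eigenvector (M : Matrix (Fin 2) (Fin 2) ℂ) (l : ℂ)
    (h : l ^ 2 - M.trace * l + M.det = 0) : ∃ z ≠ 0, M.mulVec z = l • z := by
  have hdet : (M - l • 1).det = 0 := by
    rw [Matrix.trace_fin_two, Matrix.det_fin_two] at h
    rw [Matrix.det_fin_two]
    simp
    linear_combination h
  obtain ⟨z, hz, hMz⟩ := Matrix.exists_mulVec_eq_zero_iff.2 hdet
  refine ⟨z, hz, ?_⟩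
  rwa [Matrix.sub_mulVec, Matrix.smul_mulVec, Matrix.one_mulVec, sub_eq_zero] at hMz

lemma exists_root (b c : ℂ) : ∃ l : ℂ, l ^ 2 - b * l + c = 0 := by
  obtain ⟨r, hr⟩ := IsAlgClosed.exists_pow_nat_eq (b ^ 2 - 4 * c) (n := 2) (by norm_num)
  exact ⟨(b + r) / 2, by linear_combination hr / 4⟩

/-- The fixed point is the rank one matrix z wᵀ, which is scaled by l m. -/
lemma exists_fixed_point {P Q : GL (Fin 2) ℂ} {z w : Fin 2 → ℂ} (hz : z ≠ 0) (hw : w ≠ 0)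
    {l m : ℂ} (hP : P.1.mulVec z = l • z) (hQ : Q.1.mulVec w = m • w) (hlm : l * m = 1) :
    ∃ x : Cone, x ≠ origin ∧ act (inner P Q) x = x := by
  refine ⟨⟨toMatrix.symm (Matrix.vecMulVec z w), ?_⟩, ?_, ?_⟩
  · change z 0 * w 0 * (z 1 * w 1) - z 0 * w 1 * (z 1 * w 0) = 0
    ring
  · intro h
    have h1 : toMatrix.symm (Matrix.vecMulVec z w) = 0 := congrArg Subtype.val h
    rw [LinearEquiv.map_eq_zero_iff] at h1
    obtain ⟨i, hi⟩ := Function.ne_iff.1 hz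
    obtain ⟨j, hj⟩ := Function.ne_iff.1 hw
    exact mul_ne_zero hi hj (congrFun (congrFun h1 i) j)
  · refine Subtype.ext ?_
    change rep (inner P Q) (toMatrix.symm (Matrix.vecMulVec z w)) = _
    rw [rep_inner, LinearEquiv.apply_symm_apply, Matrix.mul_vecMulVec, Matrix.vecMulVec_mul,
      Matrix.vecMul_transpose, hP, hQ, Matrix.smul_vecMulVec, Matrix.vecMulVec_smul, smul_smul,
      hlm, one_smul]

/-- The action is free outside of the origin. -/
def ActsFreely (G : Subgroup Sym) : Prop :=
  ∀ s ∈ G, s ≠ 1 → ∀ x : Cone, act s x = x → x = origin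

lemma ActsFreely.inner_eq_one {G : Subgroup Sym} (hG : ActsFreely G) {P Q : GL (Fin 2) ℂ}
    (h : inner P Q ∈ G) {z w : Fin 2 → ℂ} (hz : z ≠ 0) (hw : w ≠ 0) {l m : ℂ}
    (hP : P.1.mulVec z = l • z) (hQ : Q.1.mulVec w = m • w) (hlm : l * m = 1) :
    inner P Q = 1 := by
  by_contra h1
  obtain ⟨x, hx, hfix⟩ := exists_fixed_point hz hw hP hQ hlm
  exact hx (hG _ h h1 x hfix)

lemma mulVec_sq {M : Matrix (Fin 2) (Fin 2) ℂ} {z : Fin 2 → ℂ} {l : ℂ}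
    (h : M.mulVec z = l • z) : (M * M).mulVec z = (l * l) • z := by
  rw [← Matrix.mulVec_mulVec, h, Matrix.mulVec_smul, h, smul_smul]

lemma cayley_hamilton (M : Matrix (Fin 2) (Fin 2) ℂ) : M * M = M.trace • M - M.det • 1 := by
  ext i j
  rw [Matrix.trace_fin_two, Matrix.det_fin_two]
  fin_cases i <;> fin_cases j <;> simp [Matrix.mul_apply, Fin.sum_univ_two] <;> ring

lemma eq_sc_of_smul {P : GL (Fin 2) ℂ} {t c : ℂ} (ht : t ≠ 0)
    (h : t • P.1 = c • (1 : Matrix (Fin 2) (Fin 2) ℂ)) : ∃ l : ℂˣ, P = sc l := by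
  have hP : P.1 = (c / t) • (1 : Matrix (Fin 2) (Fin 2) ℂ) := by
    rw [div_eq_inv_mul, mul_smul, ← h, smul_smul, inv_mul_cancel₀ ht, one_smul]
  have hc : c / t ≠ 0 := fun h0 => by
    rw [h0, zero_smul] at hP
    have := P.isUnit
    rw [hP] at this
    exact not_isUnit_zero this
  exact ⟨Units.mk0 _ hc, Units.ext (by rw [hP, sc_coe]; rfl)⟩

lemma det_sc (l : ℂˣ) : (sc l).1.det = (l : ℂ) ^ 2 := by
  rw [sc_coe, Matrix.det_smul, Matrix.det_one]
  simp

/-- An element `(A, B)` that exchanges the two factors, in a group that acts freely, has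
scalar `A * B` if it preserves the residue form. -/
lemma ActsFreely.exists_mul_eq_sc {G : Subgroup Sym} (hG : ActsFreely G)
    {A B : GL (Fin 2) ℂ} (h : outer A B ∈ G) (hres : residueFactor (outer A B) = 1) :
    ∃ c : ℂˣ, (c : ℂ) ^ 2 = -1 ∧ A * B = sc c := by
  have hdet : (A * B).1.det = -1 := by
    rw [residueFactor_outer] at hres
    rw [Units.val_mul, Matrix.det_mul]
    linear_combination -hres
  have hdet' : (B * A).1.det = -1 := by
    rw [Units.val_mul, Matrix.det_mul, mul_comm, ← Matrix.det_mul]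
    exact hdet
  have htr : (B * A).1.trace = (A * B).1.trace := Matrix.trace_mul_comm _ _
  have hsq : inner (A * B) (B * A) ∈ G := by
    rw [← outer_mul_outer]
    exact mul_mem h h
  obtain ⟨l, hl⟩ := exists_root (A * B).1.trace (A * B).1.det
  have hl0 : l ≠ 0 := by
    rintro rfl
    rw [hdet] at hl
    norm_num at hl
  rw [hdet] at hl
  -- AB and BA share the eigenvalues l and -1/l, whose squares are mutually inverse. So s⁴ fixes a
  -- nonzero point and is trivial, (AB)² is scalar, and by Cayley–Hamilton the trace times AB is
  -- scalar.
  obtain ⟨z, hz, hCz⟩ := exists_eigenvector (A * B).1 l (by rw [hdet]; exact hl)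
  obtain ⟨w, hw, hDw⟩ := exists_eigenvector (B * A).1 (-l⁻¹) (by
    rw [hdet', htr]
    field_simp
    linear_combination -hl)
  have h4 : inner ((A * B) * (A * B)) ((B * A) * (B * A)) = 1 := by
    refine hG.inner_eq_one ?_ hz hw (mulVec_sq hCz) (mulVec_sq hDw) (by field_simp)
    rw [← inner_mul_inner]
    exact mul_mem hsq hsq
  obtain ⟨m, hm, -⟩ := (inner_eq_one_iff _ _).1 h4
  have hm' := congrArg Units.val hm
  rw [Units.val_mul, cayley_hamilton, hdet, sc_coe] at hm'
  have hm2 : (A * B).1.trace • (A * B).1 = ((m : ℂ) - 1) • (1 : Matrix (Fin 2) (Fin 2) ℂ) := by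
    rw [sub_smul, ← hm']
    simp
  -- With trace zero, l² = 1 and s² itself fixes a nonzero point; then AB is scalar, and an
  -- invertible scalar has nonzero trace.
  by_cases ht : (A * B).1.trace = 0
  · exfalso
    obtain ⟨w', hw', hDw'⟩ := exists_eigenvector (B * A).1 l (by rw [hdet', htr]; exact hl)
    rw [ht] at hl
    have h2 := hG.inner_eq_one hsq hz hw' hCz hDw' (by linear_combination hl)
    obtain ⟨c, hc, -⟩ := (inner_eq_one_iff _ _).1 h2
    rw [hc, sc_coe] at ht
    simp at ht
  · obtain ⟨c, hc⟩ := eq_sc_of_smul ht hm2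
    refine ⟨c, ?_, hc⟩
    rw [← det_sc, ← hc, hdet]

lemma mul_comm_of_eq_sc {A B : GL (Fin 2) ℂ} {c : ℂˣ} (h : A * B = sc c) : B * A = sc c := by
  have hB : B = A⁻¹ * sc c := by rw [← h, inv_mul_cancel_left]
  rw [hB, mul_assoc, sc_comm, inv_mul_cancel_left]

lemma inner_sc_sc (a b : ℂˣ) : inner (sc a) (sc b) = inner 1 (sc (a * b)) := by
  rw [inner_eq_inner_iff]
  refine ⟨a⁻¹, ?_, ?_⟩
  · rw [← map_mul, inv_mul_cancel, map_one]
  · rw [inv_inv, ← map_mul]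

lemma outer_mul_self {A B : GL (Fin 2) ℂ} {c : ℂˣ} (hc : (c : ℂ) ^ 2 = -1) (h : A * B = sc c) :
    outer A B * outer A B = inner 1 (sc (-1)) := by
  rw [outer_mul_outer, h, mul_comm_of_eq_sc h, inner_sc_sc]
  congr 2
  ext
  rw [← sq]
  simpa using hc

/-- The elements that do not exchange the two factors. -/
lemma ActsFreely.inner_eq {G : Subgroup Sym} (hG : ActsFreely G)
    (hres : ∀ s ∈ G, residueFactor s = 1) {A B P Q : GL (Fin 2) ℂ} (hs : outer A B ∈ G)
    (hh : inner P Q ∈ G) : inner P Q = 1 ∨ inner P Q = inner 1 (sc (-1)) := by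
  obtain ⟨c, hc, hAB⟩ := hG.exists_mul_eq_sc hs (hres _ hs)
  have hhs : outer (P * A) (Q * B) ∈ G := by
    rw [← inner_mul_outer]
    exact mul_mem hh hs
  obtain ⟨d, hd, hPQ⟩ := hG.exists_mul_eq_sc hhs (hres _ hhs)
  -- Writing s and h for the two given elements, both s and h s square to Y ↦ -Y, so h s h s = s s.
  have hinv : inner P Q * outer A B * inner P Q = outer A B := by
    have h1 := (outer_mul_self hd hPQ).trans (outer_mul_self hc hAB).symm
    rw [← inner_mul_outer, ← mul_assoc] at h1
    exact mul_right_cancel h1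
  rw [inner_mul_outer, outer_mul_inner, eq_comm, outer_eq_outer_iff] at hinv
  obtain ⟨l, hl1, hl2⟩ := hinv
  have hB : B = sc c * A⁻¹ := by rw [sc_comm, ← hAB, inv_mul_cancel_left]
  -- So each eigenvalue a of P gives the eigenvalue l/a of Q; the other component of h s h = s
  -- forces l² = 1.
  have hQ : Q = A⁻¹ * (sc l * P⁻¹) * A := by
    have : Q = A⁻¹ * P⁻¹ * (P * A * Q) := by group
    rw [this, hl1]
    simp only [mul_assoc]
    rw [← mul_assoc P⁻¹, ← sc_comm, mul_assoc]
  have hl : l * l = 1 := by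
    have h1 : Q * A⁻¹ * P = sc l⁻¹ * A⁻¹ := by
      have h2 : sc c * (Q * A⁻¹ * P) = sc c * (sc l⁻¹ * A⁻¹) := by
        rw [hB] at hl2
        calc sc c * (Q * A⁻¹ * P) = Q * (sc c * A⁻¹) * P := by
              rw [← mul_assoc, ← mul_assoc, sc_comm, mul_assoc Q]
          _ = sc l⁻¹ * (sc c * A⁻¹) := hl2
          _ = sc c * (sc l⁻¹ * A⁻¹) := by rw [← mul_assoc, sc_comm, mul_assoc]
      exact mul_left_cancel h2
    have h3 : Q * A⁻¹ * P = sc l * A⁻¹ := by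
      rw [hQ, sc_comm l A⁻¹]
      simp only [mul_assoc, mul_inv_cancel_left, inv_mul_cancel, mul_one]
    have h4 : l⁻¹ = l := sc_injective (mul_right_cancel (h1.symm.trans h3))
    calc l * l = l⁻¹ * l := by rw [h4]
      _ = 1 := inv_mul_cancel l
  -- eigenvectors of `P` give eigenvectors of `Q`
  have heig : ∀ (z : Fin 2 → ℂ) (a : ℂ), z ≠ 0 → a ≠ 0 → P.1.mulVec z = a • z →
      (A⁻¹).1.mulVec z ≠ 0 ∧
        Q.1.mulVec ((A⁻¹).1.mulVec z) = ((l : ℂ) * a⁻¹) • (A⁻¹).1.mulVec z := by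
    intro z a hz ha hPz
    have hAA : ∀ v : Fin 2 → ℂ, A.1.mulVec ((A⁻¹).1.mulVec v) = v := fun v => by
      rw [Matrix.mulVec_mulVec, ← Units.val_mul, mul_inv_cancel, Units.val_one, Matrix.one_mulVec]
    have hPz' : (P⁻¹).1.mulVec z = a⁻¹ • z := by
      have h1 := congrArg (P⁻¹).1.mulVec hPz
      rw [Matrix.mulVec_mulVec, ← Units.val_mul, inv_mul_cancel, Units.val_one,
        Matrix.one_mulVec, Matrix.mulVec_smul] at h1
      conv_rhs => rw [h1]
      rw [smul_smul, inv_mul_cancel₀ ha, one_smul]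
    constructor
    · intro h0
      exact hz (by rw [← hAA z, h0, Matrix.mulVec_zero])
    · rw [hQ]
      simp only [Units.val_mul, ← Matrix.mulVec_mulVec]
      rw [hAA, hPz', sc_coe]
      simp only [Matrix.mulVec_smul, Matrix.smul_mulVec, Matrix.one_mulVec, smul_smul, mul_comm]
  have hdetP : P.1.det ≠ 0 := (Matrix.isUnit_iff_isUnit_det _).1 P.isUnit |>.ne_zero
  obtain ⟨a, ha⟩ := exists_root P.1.trace P.1.det
  have ha0 : a ≠ 0 := by
    rintro rfl
    apply hdetP
    linear_combination ha
  obtain ⟨z, hz, hPz⟩ := exists_eigenvector P.1 a ha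
  obtain ⟨hw, hQw⟩ := heig z a hz ha0 hPz
  have hl' : (l : ℂ) * l = 1 := by
    have h := congrArg Units.val hl
    rwa [Units.val_mul, Units.val_one] at h
  -- For l = 1, the eigenvalues a and 1/a give a fixed point. For l = -1 and trace zero, a pairs
  -- with the eigenvalue 1/a of Q obtained from -a. Otherwise h² fixes a point, so P² and then P are
  -- scalar and h is Y ↦ -Y.
  rcases mul_self_eq_one_iff.1 hl' with h1 | h1
  · exact Or.inl (hG.inner_eq_one hh hz hw hPz hQw (by rw [h1]; field_simp))
  by_cases ht : P.1.trace = 0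
  · left
    obtain ⟨z', hz', hPz'⟩ := exists_eigenvector P.1 (-a) (by
      rw [ht] at ha ⊢
      linear_combination ha)
    obtain ⟨hw', hQw'⟩ := heig z' (-a) hz' (neg_ne_zero.2 ha0) hPz'
    exact hG.inner_eq_one hh hz hw' hPz hQw' (by rw [h1]; field_simp)
  · right
    have h2 : inner (P * P) (Q * Q) = 1 := by
      refine hG.inner_eq_one ?_ hz hw (mulVec_sq hPz) (mulVec_sq hQw) (by rw [h1]; field_simp)
      rw [← inner_mul_inner]
      exact mul_mem hh hh
    obtain ⟨m, hm, -⟩ := (inner_eq_one_iff _ _).1 h2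
    have hm' := congrArg Units.val hm
    rw [Units.val_mul, cayley_hamilton, sc_coe, sub_eq_iff_eq_add, ← add_smul] at hm'
    obtain ⟨r, hr⟩ := eq_sc_of_smul ht hm'
    have hl1' : l = -1 := Units.ext (by simpa using h1)
    rw [hQ, hr, mul_assoc, mul_assoc, ← map_inv, sc_comm r⁻¹, ← mul_assoc (sc l), sc_comm l,
      mul_assoc, inv_mul_cancel_left, ← map_mul, inner_sc_sc, hl1']
    congr 2
    rw [mul_comm, mul_assoc, inv_mul_cancel, mul_one]

/-- The non-exchanging elements are 1 and possibly s², and any exchanging element times s is one of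
them. -/
lemma ActsFreely.eq_zpowers {G : Subgroup Sym} (hG : ActsFreely G)
    (hres : ∀ s ∈ G, residueFactor s = 1) {A B : GL (Fin 2) ℂ} (hs : outer A B ∈ G) :
    G = Subgroup.zpowers (outer A B) := by
  obtain ⟨c, hc, hAB⟩ := hG.exists_mul_eq_sc hs (hres _ hs)
  have hsq := outer_mul_self hc hAB
  have hinner : ∀ P Q, inner P Q ∈ G → inner P Q ∈ Subgroup.zpowers (outer A B) := by
    intro P Q h
    rcases hG.inner_eq hres hs h with h1 | h1
    · rw [h1]
      exact one_mem _
    · rw [h1, ← hsq]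
      exact mul_mem (Subgroup.mem_zpowers _) (Subgroup.mem_zpowers _)
  refine le_antisymm (fun t ht => ?_) (Subgroup.zpowers_le.2 hs)
  rcases eq_inner_or_eq_outer t with ⟨P, Q, rfl⟩ | ⟨P, Q, rfl⟩
  · exact hinner P Q ht
  · have h1 : inner (P * B) (Q * A) ∈ Subgroup.zpowers (outer A B) := by
      refine hinner _ _ ?_
      rw [← outer_mul_outer]
      exact mul_mem ht hs
    rw [← outer_mul_outer] at h1
    exact (Subgroup.mul_mem_cancel_right _ (Subgroup.mem_zpowers _)).1 h1

/-! ## The generator -/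

/-- Diagonal matrices. -/
def diagGL (a b : ℂˣ) : GL (Fin 2) ℂ where
  val := !![(a : ℂ), 0; 0, b]
  inv := !![((a⁻¹ : ℂˣ) : ℂ), 0; 0, ((b⁻¹ : ℂˣ) : ℂ)]
  val_inv := by ext i j; fin_cases i <;> fin_cases j <;> simp
  inv_val := by ext i j; fin_cases i <;> fin_cases j <;> simp

/-- The imaginary unit. -/
def unitI : ℂˣ := Units.mk0 Complex.I Complex.I_ne_zero

/-- The symmetry of order four. -/
def generator : Sym := outer (diagGL 1 unitI) (diagGL unitI 1)

lemma diagGL_mul_diagGL : diagGL 1 unitI * diagGL unitI 1 = sc unitI := by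
  refine Units.ext ?_
  rw [sc_coe, Units.val_mul]
  ext i j
  fin_cases i <;> fin_cases j <;> simp [diagGL]

lemma actsAsGenerator_generator : ActsAsGenerator generator := by
  intro y
  rw [generator, rep_outer_eq]
  ext i
  fin_cases i <;> simp [diagGL, unitI, mul_comm, ← mul_assoc]

lemma generator_mul_self : generator * generator = inner 1 (sc (-1)) :=
  outer_mul_self (c := unitI) (by simp [unitI]) diagGL_mul_diagGL

lemma orderOf_generator : orderOf generator = 4 := by
  refine orderOf_eq_prime_pow (p := 2) (n := 1) ?_ ?_
  · rw [pow_one, sq, generator_mul_self, inner_eq_one_iff]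
    rintro ⟨l, h1, h2⟩
    have h3 : l = 1 := sc_injective (h1.symm.trans (map_one _).symm)
    rw [h3, inv_one] at h2
    have h4 := congrArg Units.val (sc_injective h2)
    norm_num at h4
  · rw [show 2 ^ (1 + 1) = 2 * 2 from rfl, pow_mul, sq, sq, generator_mul_self, inner_mul_inner,
      ← map_mul]
    simp [inner_one]

instance finite_zpowers_generator : Finite (Subgroup.zpowers generator) := by
  refine Nat.finite_of_card_ne_zero ?_
  rw [Nat.card_zpowers, orderOf_generator]
  norm_num

lemma residueFactor_generator : residueFactor generator = 1 := by
  rw [generator, residueFactor_outer]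
  simp [diagGL, unitI, Matrix.det_fin_two]

lemma residueFactor_of_mem_zpowers {s : Sym} (hs : s ∈ Subgroup.zpowers generator) :
    residueFactor s = 1 := by
  let S : Subgroup Sym :=
    { carrier := {s | residueFactor s = 1}
      one_mem' := residueFactor_one
      mul_mem' := fun {s t} hs ht => by
        change residueFactor (s * t) = 1
        rw [residueFactor_mul, hs, ht, one_mul]
      inv_mem' := fun {s} hs => by
        have h := residueFactor_mul s s⁻¹
        rw [mul_inv_cancel, residueFactor_one, hs, one_mul] at h
        exact h.symm }
  exact (Subgroup.zpowers_le (H := S)).2 residueFactor_generator hs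

lemma actsFreely_generator : ActsFreely (Subgroup.zpowers generator) := by
  intro s hs h1 x hx
  have hact := actsAsGenerator_generator.act_apply
  have hfix : act generator x = x → x = origin := fun h => by
    have h2 := congrArg Subtype.val h
    rw [hact] at h2
    have e0 := congrFun h2 0
    have e1 := congrFun h2 1
    have e2 := congrFun h2 2
    have e3 := congrFun h2 3
    simp only [Matrix.cons_val] at e0 e1 e2 e3
    have i1 : Complex.I ≠ 1 := fun h => by simpa using congrArg Complex.im h
    have hI : ∀ a : ℂ, Complex.I * a = a → a = 0 := fun a ha => by
      have : (Complex.I - 1) * a = 0 := by linear_combination ha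
      exact (mul_eq_zero.1 this).resolve_left (sub_ne_zero.2 i1)
    have h12 : x.1 1 = 0 := by linear_combination (-1 / 2) * e1 - (1 / 2) * e2
    refine Subtype.ext (funext fun i => ?_)
    fin_cases i
    · exact hI _ e0
    · exact h12
    · exact e1.trans h12
    · exact hI _ e3
  have hfin : IsOfFinOrder generator := by
    rw [← orderOf_pos_iff, orderOf_generator]
    norm_num
  classical
  rw [hfin.mem_zpowers_iff_mem_range_orderOf, orderOf_generator, Finset.mem_image] at hs
  obtain ⟨n, hn, rfl⟩ := hs
  rw [Finset.mem_range] at hn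
  interval_cases n
  · exact absurd (pow_zero _) h1
  · rw [pow_one] at hx
    exact hfix hx
  · rw [sq, act_mul, actsAsGenerator_generator.act_sq] at hx
    refine Subtype.ext (funext fun i => ?_)
    have := congrFun (congrArg Subtype.val hx) i
    simp [scale] at this
    change x.1 i = 0
    linear_combination (-1 / 2 : ℂ) * this
  -- A point fixed by the inverse g³ of g is fixed by g.
  · refine hfix ?_
    have h4 : generator * generator ^ 3 = 1 := by
      have h5 := pow_orderOf_eq_one generator
      rwa [orderOf_generator, pow_succ'] at h5
    conv_lhs => rw [← hx]
    rw [← act_mul, h4, act_one]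

lemma isHyperconifold_generator : IsHyperconifold (Subgroup.zpowers generator) where
  finite := finite_zpowers_generator
  free := actsFreely_generator
  isolated x := by
    constructor
    · intro h
      by_contra hx
      exact h (isSmoothAt_of_ne_origin _ actsFreely_generator hx)
    · rintro rfl
      exact actsAsGenerator_generator.not_isSmoothAt_origin
  gorenstein := invertible_canonicalModule _ fun _ hs => residueFactor_of_mem_zpowers hs

/-! ## Uniqueness -/

lemma exists_conj_eq_generator {A B : GL (Fin 2) ℂ} (h : A * B = sc unitI) :
    ∃ t : Sym, MulAut.conj t (outer A B) = generator := by
  -- Conjugation by (1, M) sends (A, B) to (A M⁻¹, M B) and keeps the product AB = i; this M makes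
  -- the first entry diag(1, i), and the second is then determined.
  refine ⟨inner 1 ((diagGL 1 unitI)⁻¹ * A), ?_⟩
  rw [MulAut.conj_apply, mul_inv_eq_iff_eq_mul, inner_mul_outer, generator, outer_mul_inner,
    one_mul, mul_one, mul_inv_cancel_left, mul_assoc, h, ← diagGL_mul_diagGL, inv_mul_cancel_left]

lemma inv_outer {A B : GL (Fin 2) ℂ} {c : ℂˣ} (hc : (c : ℂ) ^ 2 = -1) (h : A * B = sc c) :
    (outer A B)⁻¹ = outer A (sc (-1) * B) := by
  rw [inv_eq_iff_mul_eq_one, outer_mul_outer, mul_comm_of_eq_sc h, ← mul_assoc, ← sc_comm,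
    mul_assoc, h, ← map_mul, inner_sc_sc, inner_eq_one_iff]
  refine ⟨1, (map_one _).symm, ?_⟩
  congr 1
  ext
  push_cast
  linear_combination (-1 : ℂ) * hc

/-- Since c = ±i and the inverse (A, -B) has the scalar -c, one of the two generators of the cyclic
group has scalar i. -/
lemma exists_conj_zpowers {A B : GL (Fin 2) ℂ} {c : ℂˣ} (hc : (c : ℂ) ^ 2 = -1)
    (h : A * B = sc c) :
    ∃ t : Sym, (Subgroup.zpowers (outer A B)).map (MulAut.conj t).toMonoidHom
      = Subgroup.zpowers generator := by
  have hcI : c = unitI ∨ -1 * c = unitI := by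
    have h1 : ((c : ℂ) - Complex.I) * (c + Complex.I) = 0 := by
      linear_combination hc - Complex.I_sq
    rcases mul_eq_zero.1 h1 with h2 | h2
    · exact Or.inl (Units.ext (sub_eq_zero.1 h2))
    · refine Or.inr (Units.ext ?_)
      change (-1 * (c : ℂ)) = Complex.I
      linear_combination -h2
  rcases hcI with rfl | hcI
  · obtain ⟨t, ht⟩ := exists_conj_eq_generator h
    refine ⟨t, ?_⟩
    rw [MonoidHom.map_zpowers]
    exact congrArg Subgroup.zpowers ht
  · obtain ⟨t, ht⟩ := exists_conj_eq_generator (A := A) (B := sc (-1) * B) (by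
      rw [← mul_assoc, ← sc_comm, mul_assoc, h, ← map_mul, hcI])
    refine ⟨t, ?_⟩
    rw [← Subgroup.zpowers_inv, MonoidHom.map_zpowers, inv_outer hc h]
    exact congrArg Subgroup.zpowers ht

/-- Conjugate groups have isomorphic quotients. -/
lemma nonempty_algEquiv_of_map_conj {G H : Subgroup Sym} (t : Sym)
    (h : G.map (MulAut.conj t).toMonoidHom = H) :
    Nonempty (quotientRing G ≃ₐ[ℂ] quotientRing H) := by
  subst h
  refine ⟨AlgEquiv.ofAlgHom
    { toFun := fun f => ⟨fun x => f.1 (act t⁻¹ x), comp_act_mem f.2.1 _, ?_⟩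
      map_one' := rfl
      map_mul' := fun _ _ => rfl
      map_zero' := rfl
      map_add' := fun _ _ => rfl
      commutes' := fun _ => rfl }
    { toFun := fun f => ⟨fun x => f.1 (act t x), comp_act_mem f.2.1 _, ?_⟩
      map_one' := rfl
      map_mul' := fun _ _ => rfl
      map_zero' := rfl
      map_add' := fun _ _ => rfl
      commutes' := fun _ => rfl } ?_ ?_⟩
  · rintro _ ⟨s, hs, rfl⟩ x
    change f.1 (act t⁻¹ (act (t * s * t⁻¹) x)) = _
    rw [act_mul, act_mul, act_inv_act, f.2.2 s hs]
  · intro s hs x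
    have h1 := f.2.2 (t * s * t⁻¹) ⟨s, hs, rfl⟩ (act t x)
    rwa [act_mul, act_inv_act, act_mul] at h1
  · ext f x
    exact congrArg f.1 (act_act_inv t x)
  · ext f x
    exact congrArg f.1 (act_inv_act t x)

end Conifold

end

theorem mainTheorem12 :
    ∃ g : Conifold.Sym,
      (∀ y : Conifold.V, Conifold.rep g y = ![Complex.I * y 0, y 2, -y 1, Complex.I * y 3]) ∧
      orderOf g = 4 ∧
      Conifold.IsHyperconifold (Subgroup.zpowers g) ∧
      Conifold.ProjectsNontrivially (Subgroup.zpowers g) ∧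
      ∀ G : Subgroup Conifold.Sym,
        Conifold.IsHyperconifold G → Conifold.ProjectsNontrivially G →
          (∃ t : Conifold.Sym, G.map (MulAut.conj t).toMonoidHom = Subgroup.zpowers g) ∧
          Nonempty (Conifold.quotientRing G ≃ₐ[ℂ]
            Conifold.quotientRing (Subgroup.zpowers g)) := by
  refine ⟨Conifold.generator, Conifold.actsAsGenerator_generator, Conifold.orderOf_generator,
    Conifold.isHyperconifold_generator,
    ⟨_, Subgroup.mem_zpowers _, Conifold.toZTwo_outer _ _⟩, fun G hG ⟨s, hs, hs1⟩ => ?_⟩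
  have := hG.finite
  have hfree : Conifold.ActsFreely G := hG.free
  have hres := Conifold.residueFactor_eq_one G hfree hG.gorenstein
  rcases Conifold.eq_inner_or_eq_outer s with ⟨A, B, rfl⟩ | ⟨A, B, rfl⟩
  · exact absurd (Conifold.toZTwo_inner A B) hs1
  obtain ⟨c, hc, hAB⟩ := hfree.exists_mul_eq_sc hs (hres _ hs)
  obtain ⟨t, ht⟩ := Conifold.exists_conj_zpowers hc hAB
  rw [← hfree.eq_zpowers hres hs] at ht
  exact ⟨⟨t, ht⟩, Conifold.nonempty_algEquiv_of_map_conj t ht⟩
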